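/- Let $c_0>0$ and let $\mu$ be a probability density on $[0,1]$ (with respect to Lebesgue measure) with $\mu(x)\ge c_0$ for all $x\in[0,1]$. For $p\in\mathbb N$ let $X_1,\dots,X_p$ be i.i.d. with density $\mu$, let $\mu^p$ be their joint law on $[0,1]^p$, and put $d_n(f_1,f_2)=\big(\int_{[0,1]^p}(f_1-f_2)^2\,d\mu^p\big)^{1/2}$ on $\mathbb L_2(\mu^p;[0,1]^p)$. For $I\subseteq\{1,\dots,p\}$ and $a>0$ let $\mathbb H^a_I$ denote the unit ball of the reproducing kernel Hilbert space of the squared exponential kernel $K^a_I(x,y)=\exp(-a^2\|x-y\|^2)$ on $[0,1]^I$, where a function $f$ on $[0,1]^I$ is identified with the function $x\mapsto f(x_I)$ on $[0,1]^p$. Let $N(\varepsilon,\mathbb H^a_I,d_n)$ be the least number of closed $d_n$-balls of radius $\varepsilon$, with arbitrary centres in $\mathbb L_2(\mu^p;[0,1]^p)$, that cover $\mathbb H^a_I$. Then there is a constant $C>0$, depending only on $c_0$ and $\mu$ (not on $p$, $I$, $a$, $\varepsilon$), such that for all $p$, all $I\subseteq\{1,\dots,p\}$, all $a\ge 2$ and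 all $\varepsilon\in(0,a^{-|I|/2})$, $$\log N(\varepsilon,\mathbb H^a_I,d_n)\ \ge\ C\,\frac{a^{|I|}}{|I|^{|I|}}\,\Big(\log\frac{1}{\varepsilon\,a^{|I|/2}}\Big)^{\frac{|I|+2}{2}},$$ except that, when $2\le a<3$ and $(c_0/a)^{|I|/2}\le\varepsilon<a^{-|I|/2}$, it is assumed in addition that $N(\varepsilon,\mathbb H^a_I,d_n)\neq 1$, i.e. that a single $d_n$-ball of radius $\varepsilon$ does not already cover $\mathbb H^a_I$. (For $I=\emptyset$, $0^0=1$.) -/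

import Mathlib

open MeasureTheory
open scoped unitInterval ENNReal NNReal

noncomputable section

/-- The squared exponential kernel `K_I^a(x, y) = exp (-a² ‖x - y‖²)` on `[0,1]^I`, where `‖·‖` is
the Euclidean norm. -/
def sqExpKernel {ι : Type*} [Fintype ι] (a : ℝ) (x y : ι → I) : ℝ :=
  Real.exp (-(a ^ 2 * ∑ j, ((x j : ℝ) - (y j : ℝ)) ^ 2))

/-- The squared exponential kernel in the operator-valued form used by `RKHS.OfKernel`: the entry
at `(x, y)` is multiplication by `K_I^a(x, y)` on `ℝ`. -/
def sqExpMatrix (ι : Type*) [Fintype ι] (a : ℝ) : Matrix (ι → I) (ι → I) (ℝ →L[ℝ] ℝ) :=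
  Matrix.of fun x y => sqExpKernel a x y • ContinuousLinearMap.id ℝ ℝ

theorem sqExpKernel_symm {ι : Type*} [Fintype ι] (a : ℝ) (x y : ι → I) :
    sqExpKernel a x y = sqExpKernel a y x := by
  unfold sqExpKernel
  congr 3
  exact Finset.sum_congr rfl fun j _ => by ring

/-- The kernel as a Gaussian average of products of trigonometric features. -/
theorem sqExpKernel_eq_integral {ι : Type*} [Fintype ι] (a : ℝ) (x y : ι → I) :
    sqExpKernel a x y =
      ∫ ξ, Real.cos (inner ℝ ξ (WithLp.toLp 2 (fun j => √2 * a * ((x j : ℝ))) -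
          WithLp.toLp 2 (fun j => √2 * a * ((y j : ℝ)))))
        ∂(ProbabilityTheory.stdGaussian (EuclideanSpace ℝ ι)) := by
  set t : EuclideanSpace ℝ ι := WithLp.toLp 2 (fun j => √2 * a * ((x j : ℝ))) -
          WithLp.toLp 2 (fun j => √2 * a * ((y j : ℝ))) with ht
  have h := congrArg Complex.re (ProbabilityTheory.charFun_stdGaussian t)
  have hint : Integrable (fun ξ : EuclideanSpace ℝ ι =>
      Complex.exp ((inner ℝ ξ t : ℝ) * Complex.I))
      (ProbabilityTheory.stdGaussian (EuclideanSpace ℝ ι)) := by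
    refine Integrable.mono' (integrable_const (1 : ℝ)) (by fun_prop) (ae_of_all _ fun ξ => ?_)
    rw [Complex.norm_exp_ofReal_mul_I]
  rw [charFun_apply] at h
  have h2 := integral_re hint
  simp only [RCLike.re_to_complex] at h2
  rw [← h2] at h
  simp only [Complex.exp_ofReal_mul_I_re] at h
  rw [h]
  have hn : ‖t‖ ^ 2 = 2 * (a ^ 2 * ∑ j, ((x j : ℝ) - (y j : ℝ)) ^ 2) := by
    rw [EuclideanSpace.norm_sq_eq, Finset.mul_sum, Finset.mul_sum]
    refine Finset.sum_congr rfl fun j _ => ?_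
    simp only [ht, PiLp.sub_apply, Real.norm_eq_abs, sq_abs]
    have h2 : √2 ^ 2 = (2 : ℝ) := Real.sq_sqrt (by norm_num)
    linear_combination (a ^ 2 * ((x j : ℝ) - (y j : ℝ)) ^ 2) * h2
  have : (-(‖t‖ : ℂ) ^ 2 / 2) = ((-(‖t‖ ^ 2 / 2) : ℝ) : ℂ) := by push_cast; ring
  rw [this, Complex.exp_ofReal_re, hn]
  unfold sqExpKernel
  congr 1
  ring

/-- The squared exponential kernel is positive semidefinite. -/
theorem posSemidef_sqExpMatrix (ι : Type*) [Fintype ι] (a : ℝ) :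
    (sqExpMatrix ι a).PosSemidef := by
  have htfae := (RKHS.posSemidef_tfae (K := sqExpMatrix ι a)).out 0 2
  rw [htfae]
  refine ⟨?_, fun c => ?_⟩
  · ext x y
    have h1 : star (ContinuousLinearMap.id ℝ ℝ) = ContinuousLinearMap.id ℝ ℝ :=
      star_one (ℝ →L[ℝ] ℝ)
    simp [sqExpMatrix, sqExpKernel_symm a x y, Matrix.conjTranspose_apply, h1]
  · simp only [RCLike.re_to_real]
    set u : (ι → I) → EuclideanSpace ℝ ι :=
      fun x => WithLp.toLp 2 (fun j => √2 * a * ((x j : ℝ))) with hu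
    set γ := ProbabilityTheory.stdGaussian (EuclideanSpace ℝ ι) with hγ
    have hi : ∀ x y : ι → I, Integrable (fun ξ => Real.cos (inner ℝ ξ (u x - u y))) γ := by
      intro x y
      refine Integrable.mono' (integrable_const (1 : ℝ)) (by fun_prop) (ae_of_all _ fun ξ => ?_)
      exact Real.abs_cos_le_one _
    have key : (c.sum fun x w => c.sum fun x' w' => inner ℝ (sqExpMatrix ι a x' x w) w') =
        ∫ ξ, (∑ x ∈ c.support, c x * Real.cos (inner ℝ ξ (u x))) ^ 2 +
          (∑ x ∈ c.support, c x * Real.sin (inner ℝ ξ (u x))) ^ 2 ∂γ := by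
      have h1 : ∀ ξ : EuclideanSpace ℝ ι,
          (∑ x ∈ c.support, c x * Real.cos (inner ℝ ξ (u x))) ^ 2 +
            (∑ x ∈ c.support, c x * Real.sin (inner ℝ ξ (u x))) ^ 2 =
          ∑ x ∈ c.support, ∑ y ∈ c.support,
            c x * c y * Real.cos (inner ℝ ξ (u y - u x)) := by
        intro ξ
        rw [sq, sq, Finset.sum_mul_sum, Finset.sum_mul_sum, ← Finset.sum_add_distrib]
        refine Finset.sum_congr rfl fun x _ => ?_
        rw [← Finset.sum_add_distrib]
        refine Finset.sum_congr rfl fun y _ => ?_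
        rw [inner_sub_right, Real.cos_sub]
        ring
      simp_rw [h1]
      rw [integral_finsetSum _ fun x _ => integrable_finsetSum _ fun y _ => (hi y x).const_mul _]
      refine Finset.sum_congr rfl fun x _ => ?_
      rw [integral_finsetSum _ fun y _ => (hi y x).const_mul _]
      refine Finset.sum_congr rfl fun y _ => ?_
      rw [integral_const_mul, hu, hγ, ← sqExpKernel_eq_integral]
      simp [sqExpMatrix]
      ring
    rw [key]
    exact integral_nonneg fun ξ => by positivity

instance fact_posSemidef_sqExpMatrix (ι : Type*) [Fintype ι] (a : ℝ) :
    Fact (sqExpMatrix ι a).PosSemidef :=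
  ⟨posSemidef_sqExpMatrix ι a⟩

/-- The reproducing kernel Hilbert space of the squared exponential kernel on `[0,1]^ι`. -/
abbrev SqExpRKHS (ι : Type*) [Fintype ι] (a : ℝ) : Type _ :=
  RKHS.OfKernel (sqExpMatrix ι a)

/-- The unit ball of the squared exponential RKHS, as a set of functions on `[0,1]^ι`. -/
def sqExpBall (ι : Type*) [Fintype ι] (a : ℝ) : Set ((ι → I) → ℝ) :=
  {f | ∃ h : SqExpRKHS ι a, ‖h‖ ≤ 1 ∧ (h : (ι → I) → ℝ) = f}

/-- `μ` is a probability density (with respect to Lebesgue measure) on the unit interval that is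
bounded below by `c₀`. -/
structure IsDesignDensity (c₀ : ℝ) (μ : I → ℝ) : Prop where
  measurable : Measurable μ
  lower_bound : ∀ x, c₀ ≤ μ x
  lintegral_eq_one : ∫⁻ x, ENNReal.ofReal (μ x) = 1

/-- The law on `[0,1]^p` of a covariate vector `(X₁, …, X_p)` with independent coordinates of
common density `μ`. -/
def designLaw (μ : I → ℝ) (p : ℕ) : Measure (Fin p → I) :=
  Measure.pi fun _ => (volume : Measure I).withDensity fun x => ENNReal.ofReal (μ x)

/-- The unit ball of the squared exponential RKHS for the covariates in `J ⊆ [p]`, in the space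
`L₂(μ^p; [0,1]^p)`: a function `f` on `[0,1]^J` is read as `x ↦ f(x_J)`. The distance of this
space is `d_n(f₁, f₂) = (∫ (f₁ - f₂)² dμ^p)^{1/2}`. -/
def designBall (μ : I → ℝ) {p : ℕ} (J : Finset (Fin p)) (a : ℝ) : Set (Lp ℝ 2 (designLaw μ p)) :=
  {F | ∃ f ∈ sqExpBall J a, F =ᵐ[designLaw μ p] fun x => f fun j => x j}

/-- The covering number `N(ε, ℍ^a_J, d_n)`: the least number of closed `d_n`-balls of radius `ε`,
with arbitrary centres in `L₂(μ^p; [0,1]^p)`, that cover the unit ball. -/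
def designCoveringNumber (μ : I → ℝ) {p : ℕ} (J : Finset (Fin p)) (a : ℝ) (ε : ℝ≥0) : ℕ∞ :=
  Metric.externalCoveringNumber ε (designBall μ J a)

end

/-! Write `d = |J|` and `L = log (1 / (ε a^(d/2)))`. Suppose that some `k`-dimensional space of
one-variable functions satisfies `‖f‖²_{L²(μ)} ≥ l ‖f‖²` in the coefficient norm of the Taylor
features of the kernel; this is `HasSpectralSubspace`. After simultaneous diagonalisation, its
`d`-fold tensor power has dimension `k^d` and constant `l^d`, and its unit ball lies in the RKHS
ball. Comparing volumes gives `log N ≥ k^d ((d/2) log l - log ε)`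
(`log_le_log_designCoveringNumber`).

With `l = a⁻¹ exp (-B (k/a)²)` the right side is `k^d (L - d B (k/a)² / 2)`, and `k` of order `a √(L
/ (B d))` yields the rate. The factor `√(B d)^d` is at most `d^d e^(B/2)`, so the constant does not
depend on `d`.

The delicate point is the prefactor of `l`. It must be exactly `1 / a`: a factor `c < 1` would cost
`(d/2) log (1/c)`, which may exceed `L`. Two estimates are combined in
`IsDesignDensity.exists_spectralSubspace`. For `k ≤ c a` and large `a`, enough eigenvalues exceed `1
/ a`, by comparing the trace, the Hilbert–Schmidt norm and the operator norm of the kernel operator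
(`hasSpectralSubspace_of_bounded_density`). Otherwise `k / a` is bounded below, and a constant
prefactor can be absorbed by enlarging `B`; the bound with such a prefactor is proved for Lebesgue
measure with step functions and a Fourier comparison of Gaussian energies
(`hasSpectralSubspace_unitLebesgue`), then transferred through `μ ≥ c₀`.

For small `L` only `k = 1` is available. If `a ≥ 3`, the constant density gives `l = 1 / a` for
every `μ`. If `a < 3`, the target is bounded by a constant once `L ≤ 4 B d`, so it suffices that `N
≥ 2`. -/

/-! ### Volumetric lower bound for covering numbers -/

/-- A linear image of the Euclidean unit ball along which norms shrink at most by the factor `s`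
has external covering number at least `(s / ε) ^ dim`. -/
theorem ofReal_pow_le_externalCoveringNumber {E F : Type*} [NormedAddCommGroup E]
    [InnerProductSpace ℝ E] [FiniteDimensional ℝ E] [NormedAddCommGroup F] [InnerProductSpace ℝ F]
    (T : E →ₗ[ℝ] F) {s : ℝ} (hs : 0 < s) (hT : ∀ x, s * ‖x‖ ≤ ‖T x‖) {A : Set F}
    (hA : ∀ x, ‖x‖ ≤ 1 → T x ∈ A) {ε : ℝ≥0} (hε : 0 < ε) :
    ENNReal.ofReal ((s / ε) ^ Module.finrank ℝ E) ≤
      ((Metric.externalCoveringNumber ε A : ℕ∞) : ℝ≥0∞) := by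
  have hε' : (0 : ℝ) < ε := hε
  suffices h : ∀ C : Set F, Metric.IsCover ε A C →
      ENNReal.ofReal ((s / ε) ^ Module.finrank ℝ E) ≤ ((C.encard : ℕ∞) : ℝ≥0∞) by
    have hne : ∃ C : Set F, Metric.IsCover ε A C := ⟨A, by simp⟩
    obtain ⟨C, hC, hCe⟩ : ∃ C : Set F, Metric.IsCover ε A C ∧
        Metric.externalCoveringNumber ε A = C.encard := by
      have hne' : (Set.encard '' {C : Set F | Metric.IsCover ε A C}).Nonempty := Set.Nonempty.image _ hne
      have := csInf_mem hne'
      rw [sInf_image] at this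
      obtain ⟨C, hC, hCe⟩ := this
      exact ⟨C, hC, hCe.symm⟩
    rw [hCe]
    exact h C hC
  intro C hC
  rcases C.finite_or_infinite with hfin | hinf
  swap
  · simp [hinf.encard_eq]
  borelize E
  let R := LinearMap.range T
  -- Centres may lie off the range of `T`. Projecting them orthogonally onto it does not increase
  -- distances to points `T x`, so they can be pulled back to `E`, where the balls get radius `ε /
  -- s`.
  have hex : ∀ z : F, ∃ y : E, T y = (R.starProjection z : F) := fun z => by
    have := R.starProjection_apply_mem z
    exact this
  choose y hy using hex
  have hcov : Metric.closedBall (0 : E) 1 ⊆ ⋃ z ∈ hfin.toFinset, Metric.closedBall (y z) (ε / s) := by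
    intro x hx
    have hx1 : ‖x‖ ≤ 1 := by simpa using hx
    obtain ⟨z, hzC, hz⟩ := hC (hA x hx1)
    have hz' : ‖T x - z‖ ≤ ε := by
      have h2 : edist (T x) z ≤ ε := hz
      rw [edist_nndist] at h2
      have h3 : nndist (T x) z ≤ ε := by exact_mod_cast h2
      rw [← dist_eq_norm]
      exact_mod_cast h3
    simp only [Set.mem_iUnion]
    refine ⟨z, by simpa using hzC, ?_⟩
    rw [Metric.mem_closedBall, dist_eq_norm, le_div_iff₀ hs, mul_comm]
    refine (hT _).trans ?_
    rw [map_sub, hy]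
    have h1 : T x = R.starProjection (T x) :=
      (Submodule.starProjection_eq_self_iff.2 (LinearMap.mem_range_self T x)).symm
    rw [h1, ← map_sub]
    exact (R.norm_starProjection_apply_le _).trans hz'
  let μ : Measure E := Measure.addHaar
  have h1 : μ (Metric.closedBall 0 1) ≤
      ∑ z ∈ hfin.toFinset, μ (Metric.closedBall (y z) (ε / s)) :=
    (measure_mono hcov).trans (measure_biUnion_finset_le _ _)
  have hr : (0 : ℝ) ≤ ε / s := by positivity
  simp_rw [Measure.addHaar_closedBall μ _ hr] at h1
  rw [Finset.sum_const, nsmul_eq_mul, Measure.addHaar_closedBall μ _ zero_le_one, one_pow,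
    ENNReal.ofReal_one, one_mul, ← mul_assoc] at h1
  have hpos : μ (Metric.ball (0 : E) 1) ≠ 0 := (Metric.measure_ball_pos μ _ one_pos).ne'
  have hfinite : μ (Metric.ball (0 : E) 1) ≠ ∞ := measure_ball_lt_top.ne
  have h2 : 1 ≤ (hfin.toFinset.card : ℝ≥0∞) * ENNReal.ofReal ((ε / s) ^ Module.finrank ℝ E) := by
    rw [← ENNReal.mul_le_mul_iff_left hpos hfinite, one_mul]
    exact h1
  have h3 : ((C.encard : ℕ∞) : ℝ≥0∞) = hfin.toFinset.card := by
    rw [hfin.encard_eq_coe_toFinset_card]; simp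
  rw [h3]
  have h4 : ENNReal.ofReal ((s / ε) ^ Module.finrank ℝ E) *
      ENNReal.ofReal ((ε / s) ^ Module.finrank ℝ E) = 1 := by
    rw [← ENNReal.ofReal_mul (by positivity), ← mul_pow]
    rw [show s / ε * (ε / s) = 1 by field_simp]
    simp
  have h5 : ENNReal.ofReal ((ε / s) ^ Module.finrank ℝ E) ≠ 0 := by
    simp; positivity
  rw [← ENNReal.mul_le_mul_iff_left h5 ENNReal.ofReal_ne_top, h4]
  exact h2

/-! ### Membership criterion for the unit ball of an RKHS -/

namespace RKHS

/-- A function on which all finite combinations of point evaluations are bounded by the norm of the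
corresponding combination of kernel functions lies in the unit ball of the RKHS. -/
theorem exists_norm_le_one_of_bound {X H : Type*} [NormedAddCommGroup H] [InnerProductSpace ℝ H]
    [CompleteSpace H] [RKHS ℝ H X ℝ] (f : X → ℝ)
    (hf : ∀ c : X →₀ ℝ, (c.sum fun x w => w * f x) ^ 2 ≤
      c.sum fun x w => c.sum fun y w' => w * w' * kernel H y x 1) :
    ∃ h : H, ‖h‖ ≤ 1 ∧ (h : X → ℝ) = f := by
  let L : (X →₀ ℝ) →ₗ[ℝ] H := Finsupp.linearCombination ℝ fun x => kerFun H x 1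
  let G : (X →₀ ℝ) →ₗ[ℝ] ℝ := Finsupp.linearCombination ℝ f
  have hG : ∀ c, G c = c.sum fun x w => w * f x := fun c => by
    simp [G, Finsupp.linearCombination_apply]
  have hL : ∀ c, ‖L c‖ ^ 2 = c.sum fun x w => c.sum fun y w' => w * w' * kernel H y x 1 := by
    intro c
    rw [← real_inner_self_eq_norm_sq]
    simp only [L, Finsupp.linearCombination_apply, Finsupp.sum_inner, Finsupp.inner_sum]
    refine Finset.sum_congr rfl fun x _ => ?_
    refine Finset.sum_congr rfl fun y _ => ?_
    beta_reduce
    rw [inner_smul_right, inner_smul_left, kerFun_inner, kerFun_apply]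
    simp
    ring
  have hb : ∀ c, ‖G c‖ ≤ ‖L c‖ := fun c => by
    rw [← sq_le_sq₀ (norm_nonneg _) (norm_nonneg _), hL, hG, Real.norm_eq_abs, sq_abs]
    exact hf c
  -- The bound makes `∑ w k_x ↦ ∑ w f(x)` a well-defined contraction on the span of the kernel
  -- functions. Its Hahn–Banach extension is represented by a vector of norm at most one, whose
  -- point evaluations are those of `f`.
  have hker : LinearMap.ker L ≤ LinearMap.ker G := fun c hc => by
    have := hb c
    rw [LinearMap.mem_ker] at hc ⊢
    rw [hc, norm_zero] at this
    exact norm_le_zero_iff.1 this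
  obtain ⟨g, hg⟩ : ∃ g : LinearMap.range L →ₗ[ℝ] ℝ, ∀ c, g ⟨L c, LinearMap.mem_range_self L c⟩ = G c := by
    refine ⟨(LinearMap.ker L).liftQ G hker ∘ₗ L.quotKerEquivRange.symm.toLinearMap, fun c => ?_⟩
    have h1 : L.quotKerEquivRange (Submodule.Quotient.mk c) =
      ⟨L c, LinearMap.mem_range_self L c⟩ := rfl
    rw [← h1]
    simp
  let g' : LinearMap.range L →L[ℝ] ℝ := g.mkContinuous 1 (by
    rintro ⟨_, c, rfl⟩
    rw [hg, one_mul]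
    exact hb c)
  obtain ⟨φ, hφ, hφn⟩ := exists_extension_norm_eq (LinearMap.range L) g'
  refine ⟨(InnerProductSpace.toDual ℝ H).symm φ, ?_, ?_⟩
  · rw [LinearIsometryEquiv.norm_map, hφn]
    exact LinearMap.mkContinuous_norm_le _ zero_le_one _
  · ext x
    have h1 : inner ℝ (kerFun H x (1 : ℝ)) ((InnerProductSpace.toDual ℝ H).symm φ) =
      inner ℝ (1 : ℝ) (((InnerProductSpace.toDual ℝ H).symm φ : H) x) := kerFun_inner x 1 _
    rw [real_inner_comm, InnerProductSpace.toDual_symm_apply] at h1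
    have h2 : L (Finsupp.single x 1) = kerFun H x 1 := by simp [L]
    have h3 := hφ ⟨L (Finsupp.single x 1), LinearMap.mem_range_self L _⟩
    rw [LinearMap.mkContinuous_apply, hg] at h3
    simp only [h2] at h3
    rw [h1] at h3
    simpa [G] using h3

end RKHS

theorem mem_sqExpBall_of_bound {ι : Type*} [Fintype ι] {a : ℝ} (f : (ι → I) → ℝ)
    (hf : ∀ c : (ι → I) →₀ ℝ, (c.sum fun x w => w * f x) ^ 2 ≤
      c.sum fun x w => c.sum fun y w' => w * w' * sqExpKernel a x y) :
    f ∈ sqExpBall ι a := by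
  refine RKHS.exists_norm_le_one_of_bound f fun c => (hf c).trans_eq ?_
  have hk : ∀ x y, RKHS.kernel (SqExpRKHS ι a) y x (1 : ℝ) = sqExpKernel a x y := fun x y => by
    have h : RKHS.kernel (SqExpRKHS ι a) = sqExpMatrix ι a := RKHS.OfKernel.kernel_ofKernel
    rw [h, sqExpKernel_symm a x y]
    simp [sqExpMatrix]
  refine Finset.sum_congr rfl fun x _ => Finset.sum_congr rfl fun y _ => ?_
  beta_reduce
  exact congrArg _ (hk x y).symm

/-! ### Taylor features of the squared exponential kernel -/

/-- The features in the Taylor expansion of `exp (-a² (x - y)²)`. -/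
noncomputable def sqExpFeature (a : ℝ) (i : ℕ) (x : ℝ) : ℝ :=
  Real.exp (-(a * x) ^ 2) * ((√2 * a * x) ^ i / √(i.factorial : ℝ))

/-- The truncated Taylor expansion of `exp (-a² (x - y)²)`. -/
noncomputable def sqExpPartialKernel (a : ℝ) (n : ℕ) (x y : ℝ) : ℝ :=
  ∑ i : Fin n, sqExpFeature a i x * sqExpFeature a i y

/-- The function with coefficients `v` in the Taylor features. -/
noncomputable def featureSum (a : ℝ) {n : ℕ} (v : EuclideanSpace ℝ (Fin n)) (x : ℝ) : ℝ :=
  ∑ i, v i * sqExpFeature a i x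

@[fun_prop]
theorem continuous_sqExpFeature (a : ℝ) (i : ℕ) : Continuous (sqExpFeature a i) := by
  unfold sqExpFeature; fun_prop

@[fun_prop]
theorem continuous_featureSum (a : ℝ) {n : ℕ} (v : EuclideanSpace ℝ (Fin n)) :
    Continuous (featureSum a v) := by
  unfold featureSum; fun_prop

theorem sqExpFeature_mul (a : ℝ) (i : ℕ) (x y : ℝ) :
    sqExpFeature a i x * sqExpFeature a i y =
      Real.exp (-(a * x) ^ 2 - (a * y) ^ 2) * ((2 * a ^ 2 * x * y) ^ i / i.factorial) := by
  unfold sqExpFeature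
  have h : √(i.factorial : ℝ) * √(i.factorial : ℝ) = i.factorial :=
    Real.mul_self_sqrt (by positivity)
  have h2 : (√2 * a * x) * (√2 * a * y) = 2 * a ^ 2 * x * y := by
    have : √2 * √2 = (2 : ℝ) := Real.mul_self_sqrt (by norm_num)
    linear_combination (a ^ 2 * x * y) * this
  rw [sub_eq_add_neg, Real.exp_add, ← h2, mul_pow (√2 * a * x), mul_mul_mul_comm, div_mul_div_comm, h]

theorem hasSum_sqExpFeature_mul (a x y : ℝ) :
    HasSum (fun i => sqExpFeature a i x * sqExpFeature a i y)
      (Real.exp (-(a ^ 2 * (x - y) ^ 2))) := by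
  have h := (NormedSpace.expSeries_div_hasSum_exp (2 * a ^ 2 * x * y)).mul_left
    (Real.exp (-(a * x) ^ 2 - (a * y) ^ 2))
  rw [← Real.exp_eq_exp_ℝ, ← Real.exp_add] at h
  simp_rw [sqExpFeature_mul]
  rw [show -(a ^ 2 * (x - y) ^ 2) = -(a * x) ^ 2 - (a * y) ^ 2 + 2 * a ^ 2 * x * y by ring]
  exact h

theorem sqExpPartialKernel_eq_sum_range (a : ℝ) (n : ℕ) (x y : ℝ) :
    sqExpPartialKernel a n x y = ∑ i ∈ Finset.range n, sqExpFeature a i x * sqExpFeature a i y :=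
  Fin.sum_univ_eq_sum_range (fun i => sqExpFeature a i x * sqExpFeature a i y) n

/-! ### Membership in the unit ball -/

theorem sum_sq_prod_features {ι κ : Type*} [Fintype ι] [DecidableEq ι] (s : Finset κ)
    (ψ : κ → ℝ → ℝ) (c : (ι → I) →₀ ℝ) :
    ∑ m ∈ Fintype.piFinset (fun _ : ι => s), (c.sum fun x w => w * ∏ j, ψ (m j) (x j)) ^ 2 =
      c.sum fun x w => c.sum fun y w' => w * w' * ∏ j, ∑ i ∈ s, ψ i (x j) * ψ i (y j) := by
  simp only [Finsupp.sum, sq, Finset.sum_mul_sum]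
  rw [Finset.sum_comm]
  refine Finset.sum_congr rfl fun x _ => ?_
  rw [Finset.sum_comm]
  refine Finset.sum_congr rfl fun y _ => ?_
  rw [Finset.prod_univ_sum, Finset.mul_sum]
  refine Finset.sum_congr rfl fun m _ => ?_
  rw [Finset.prod_mul_distrib]
  ring

/-- A Bessel inequality for the tensor features: the sum over the box of indices below `N` increases
with `N`, factorises over coordinates, and tends to the quadratic form of the kernel. -/
theorem sum_sq_prod_sqExpFeature_le {ι : Type*} [Fintype ι] [DecidableEq ι] (a : ℝ) (n : ℕ)
    (c : (ι → I) →₀ ℝ) :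
    ∑ m : ι → Fin n, (c.sum fun x w => w * ∏ j, sqExpFeature a (m j) (x j)) ^ 2 ≤
      c.sum fun x w => c.sum fun y w' => w * w' * sqExpKernel a x y := by
  let S : ℕ → ℝ := fun N => ∑ m ∈ Fintype.piFinset (fun _ : ι => Finset.range N),
    (c.sum fun x w => w * ∏ j, sqExpFeature a (m j) (x j)) ^ 2
  have hS : ∀ N, S N = c.sum fun x w => c.sum fun y w' =>
      w * w' * ∏ j, ∑ i ∈ Finset.range N, sqExpFeature a i (x j) * sqExpFeature a i (y j) :=
    fun N => sum_sq_prod_features _ _ c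
  have h1 : ∑ m : ι → Fin n, (c.sum fun x w => w * ∏ j, sqExpFeature a (m j) (x j)) ^ 2 = S n := by
    have := sum_sq_prod_features (ι := ι) (Finset.univ : Finset (Fin n))
      (fun i => sqExpFeature a i) c
    rw [Fintype.piFinset_univ] at this
    rw [this, hS]
    simp_rw [← sqExpPartialKernel_eq_sum_range, sqExpPartialKernel]
  have hmono : Monotone S := fun N N' h => by
    refine Finset.sum_le_sum_of_subset_of_nonneg ?_ fun _ _ _ => sq_nonneg _
    exact Fintype.piFinset_subset _ _ fun _ => Finset.range_mono h
  have hlim : Filter.Tendsto S Filter.atTop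
      (nhds (c.sum fun x w => c.sum fun y w' => w * w' * sqExpKernel a x y)) := by
    simp_rw [funext hS]
    refine tendsto_finsetSum _ fun x _ => tendsto_finsetSum _ fun y _ => Filter.Tendsto.const_mul _ ?_
    have : sqExpKernel a x y = ∏ j, Real.exp (-(a ^ 2 * ((x j : ℝ) - y j) ^ 2)) := by
      rw [sqExpKernel, ← Real.exp_sum, Finset.sum_neg_distrib, Finset.mul_sum]
    rw [this]
    exact tendsto_finsetProd _ fun j _ => (hasSum_sqExpFeature_mul a (x j) (y j)).tendsto_sum_nat
  rw [h1]
  exact hmono.ge_of_tendsto hlim n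

/-- Cauchy–Schwarz over the multi-index `m`, combined with the Bessel inequality, verifies the
membership criterion. -/
theorem prod_feature_sum_mem_sqExpBall {ι : Type*} [Fintype ι] [DecidableEq ι] (a : ℝ) (n : ℕ)
    (w : (ι → Fin n) → ℝ) (hw : ∑ m, w m ^ 2 ≤ 1) :
    (fun x : ι → I => ∑ m, w m * ∏ j, sqExpFeature a (m j) (x j)) ∈ sqExpBall ι a := by
  refine mem_sqExpBall_of_bound _ fun c => ?_
  have h1 : (c.sum fun x t => t * ∑ m, w m * ∏ j, sqExpFeature a (m j) (x j)) =
      ∑ m, w m * (c.sum fun x t => t * ∏ j, sqExpFeature a (m j) (x j)) := by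
    simp only [Finsupp.sum, Finset.mul_sum]
    rw [Finset.sum_comm]
    exact Finset.sum_congr rfl fun m _ => Finset.sum_congr rfl fun x _ => by ring
  rw [h1]
  refine (Finset.sum_mul_sq_le_sq_mul_sq _ _ _).trans ?_
  have h2 := sum_sq_prod_sqExpFeature_le a n c
  have h3 : 0 ≤ ∑ m : ι → Fin n, (c.sum fun x w => w * ∏ j, sqExpFeature a (m j) (x j)) ^ 2 :=
    Finset.sum_nonneg fun _ _ => sq_nonneg _
  nlinarith

/-! ### Spectral subspaces -/

/-- There is a `k`-dimensional space of combinations of finitely many Taylor features on which the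
squared `L²(ν)`-norm is at least `l` times the squared RKHS norm. -/
def HasSpectralSubspace (ν : Measure ℝ) (a : ℝ) (k : ℕ) (l : ℝ) : Prop :=
  ∃ (n : ℕ) (V : Submodule ℝ (EuclideanSpace ℝ (Fin n))), k ≤ Module.finrank ℝ V ∧
    ∀ v ∈ V, l * ‖v‖ ^ 2 ≤ ∫ x, featureSum a v x ^ 2 ∂ν

theorem HasSpectralSubspace.mono {ν : Measure ℝ} {a : ℝ} {k k' : ℕ} {l l' : ℝ}
    (h : HasSpectralSubspace ν a k l) (hk : k' ≤ k) (hl : l' ≤ l) :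
    HasSpectralSubspace ν a k' l' := by
  obtain ⟨n, V, hV, hvV⟩ := h
  exact ⟨n, V, hk.trans hV, fun v hv =>
    (mul_le_mul_of_nonneg_right hl (sq_nonneg _)).trans (hvV v hv)⟩

theorem integrable_of_continuous_of_Icc {ν : Measure ℝ} [IsFiniteMeasure ν]
    (hν : ν (Set.Icc 0 1)ᶜ = 0) {f : ℝ → ℝ} (hf : Continuous f) : Integrable f ν := by
  have h : ν.restrict (Set.Icc 0 1) = ν := Measure.restrict_eq_self_of_ae_mem hν
  rw [← h]
  exact hf.continuousOn.integrableOn_compact isCompact_Icc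

theorem HasSpectralSubspace.mono_measure {ν ν' : Measure ℝ} [IsFiniteMeasure ν'] {a : ℝ} {k : ℕ}
    {l : ℝ} (h : HasSpectralSubspace ν a k l) (hν : ν ≤ ν') (hν' : ν' (Set.Icc 0 1)ᶜ = 0) :
    HasSpectralSubspace ν' a k l := by
  obtain ⟨n, V, hV, hvV⟩ := h
  refine ⟨n, V, hV, fun v hv => (hvV v hv).trans ?_⟩
  exact integral_mono_measure hν (Filter.Eventually.of_forall fun x => sq_nonneg _)
    (integrable_of_continuous_of_Icc hν' (by fun_prop))

theorem HasSpectralSubspace.smul_measure {ν : Measure ℝ} {a : ℝ} {k : ℕ}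
    {l : ℝ} (h : HasSpectralSubspace ν a k l) {c : ℝ} (hc : 0 ≤ c) :
    HasSpectralSubspace (ENNReal.ofReal c • ν) a k (c * l) := by
  obtain ⟨n, V, hV, hvV⟩ := h
  refine ⟨n, V, hV, fun v hv => ?_⟩
  rw [integral_smul_measure, ENNReal.toReal_ofReal hc, smul_eq_mul, mul_assoc]
  exact mul_le_mul_of_nonneg_left (hvV v hv) hc

/-- The Gram matrix of the first Taylor features in `L²(ν)`. -/
noncomputable def featureGram (ν : Measure ℝ) (a : ℝ) (n : ℕ) : Matrix (Fin n) (Fin n) ℝ :=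
  Matrix.of fun i j => ∫ x, sqExpFeature a i x * sqExpFeature a j x ∂ν

theorem inner_featureGram {ν : Measure ℝ} [IsFiniteMeasure ν] (hν : ν (Set.Icc 0 1)ᶜ = 0)
    (a : ℝ) {n : ℕ} (u v : EuclideanSpace ℝ (Fin n)) :
    inner ℝ (Matrix.toEuclideanLin (featureGram ν a n) u) v =
      ∫ x, featureSum a u x * featureSum a v x ∂ν := by
  have h : ∀ x, featureSum a u x * featureSum a v x =
      ∑ i, ∑ j, u j * v i * (sqExpFeature a i x * sqExpFeature a j x) := fun x => by
    rw [featureSum, featureSum, Finset.sum_mul_sum, Finset.sum_comm]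
    exact Finset.sum_congr rfl fun i _ => Finset.sum_congr rfl fun j _ => by ring
  simp_rw [h]
  have hi : ∀ i j : Fin n, Integrable (fun x => sqExpFeature a i x * sqExpFeature a j x) ν :=
    fun i j => integrable_of_continuous_of_Icc hν (by fun_prop)
  rw [integral_finsetSum _ fun i _ => integrable_finsetSum _ fun j _ => (hi i j).const_mul _]
  rw [PiLp.inner_apply]
  refine Finset.sum_congr rfl fun i _ => ?_
  rw [integral_finsetSum _ fun j _ => (hi i j).const_mul _]
  simp only [Matrix.toLpLin_apply, Matrix.mulVec, dotProduct, featureGram,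
    RCLike.inner_apply, conj_trivial, Finset.mul_sum, integral_const_mul, Matrix.of_apply]
  exact Finset.sum_congr rfl fun j _ => by ring

/-- Diagonalising the Gram operator compressed to `V` gives vectors orthonormal for the coefficients
and orthogonal in `L²(ν)` at once. Both orthogonalities pass to tensor products, which a bare lower
bound on `V` would not make evident. -/
theorem HasSpectralSubspace.exists_orthonormal {ν : Measure ℝ} [IsFiniteMeasure ν]
    (hν : ν (Set.Icc 0 1)ᶜ = 0) {a : ℝ} {k : ℕ} {l : ℝ} (h : HasSpectralSubspace ν a k l) :
    ∃ (n : ℕ) (e : Fin k → EuclideanSpace ℝ (Fin n)), Orthonormal ℝ e ∧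
      (∀ i j, i ≠ j → ∫ x, featureSum a (e i) x * featureSum a (e j) x ∂ν = 0) ∧
      ∀ i, l ≤ ∫ x, featureSum a (e i) x ^ 2 ∂ν := by
  obtain ⟨n, V, hk, hV⟩ := h
  let A := Matrix.toEuclideanLin (featureGram ν a n)
  let S : V →ₗ[ℝ] V := (V.orthogonalProjectionOnto : _ →L[ℝ] V).toLinearMap ∘ₗ A ∘ₗ V.subtype
  have hS : ∀ u v : V, inner ℝ (S u) v =
      ∫ x, featureSum a (u : EuclideanSpace ℝ (Fin n)) x * featureSum a (v : EuclideanSpace ℝ (Fin n)) x ∂ν := by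
    intro u v
    rw [← inner_featureGram hν]
    exact Submodule.inner_orthogonalProjectionOnto_eq_of_mem_right v _
  have hsymm : S.IsSymmetric := fun u v => by
    rw [hS, real_inner_comm, hS]
    simp_rw [mul_comm]
  let b := hsymm.eigenvectorBasis rfl
  refine ⟨n, fun i => (b (Fin.castLE hk i) : V), ?_, ?_, ?_⟩
  · have h1 := b.orthonormal.comp _ (Fin.castLE_injective hk)
    exact h1.comp_linearIsometry V.subtypeₗᵢ
  · intro i j hij
    rw [← hS, hsymm.apply_eigenvectorBasis, inner_smul_left]
    rw [b.orthonormal.inner_eq_zero (fun h => hij (Fin.castLE_injective hk h)), mul_zero]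
  · intro i
    have h1 := hV _ (b (Fin.castLE hk i)).2
    have h2 : ‖((b (Fin.castLE hk i) : V) : EuclideanSpace ℝ (Fin n))‖ = 1 :=
      b.orthonormal.norm_eq_one _
    rw [h2] at h1
    simpa using h1

/-! ### Tensor products of spectral subspaces -/

/-- The law of one covariate. -/
noncomputable def coordLaw (μ : I → ℝ) : Measure I :=
  (volume : Measure I).withDensity fun x => ENNReal.ofReal (μ x)

/-- The law of one covariate, as a measure on the real line. -/
noncomputable def realLaw (μ : I → ℝ) : Measure ℝ :=
  (coordLaw μ).map (fun x : I => (x : ℝ))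

theorem IsDesignDensity.isProbabilityMeasure_coordLaw {c₀ : ℝ} {μ : I → ℝ}
    (hμ : IsDesignDensity c₀ μ) : IsProbabilityMeasure (coordLaw μ) :=
  ⟨by rw [coordLaw, withDensity_apply _ MeasurableSet.univ, Measure.restrict_univ,
    hμ.lintegral_eq_one]⟩

theorem IsDesignDensity.isProbabilityMeasure_realLaw {c₀ : ℝ} {μ : I → ℝ}
    (hμ : IsDesignDensity c₀ μ) : IsProbabilityMeasure (realLaw μ) :=
  have := hμ.isProbabilityMeasure_coordLaw
  Measure.isProbabilityMeasure_map (by fun_prop)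

theorem realLaw_compl_Icc (μ : I → ℝ) : realLaw μ (Set.Icc 0 1)ᶜ = 0 := by
  rw [realLaw, Measure.map_apply (by fun_prop) measurableSet_Icc.compl]
  convert measure_empty (μ := coordLaw μ)
  ext x
  simp only [Set.mem_preimage, Set.mem_compl_iff, Set.mem_empty_iff_false, iff_false, not_not]
  exact x.2

theorem integral_realLaw (μ : I → ℝ) {f : ℝ → ℝ} (hf : Continuous f) :
    ∫ x, f x ∂(realLaw μ) = ∫ x : I, f x ∂(coordLaw μ) :=
  integral_map (by fun_prop) hf.aestronglyMeasurable

theorem integral_designLaw_prod {c₀ : ℝ} {μ : I → ℝ} (hμ : IsDesignDensity c₀ μ) {p : ℕ}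
    (J : Finset (Fin p)) (g : J → ℝ → ℝ) (hg : ∀ j, Continuous (g j)) :
    ∫ x, ∏ j : J, g j (x j) ∂(designLaw μ p) = ∏ j : J, ∫ x, g j x ∂(realLaw μ) := by
  have := hμ.isProbabilityMeasure_coordLaw
  -- Coordinates outside `J` receive the constant factor `1`, which integrates to `1` under a
  -- probability measure.
  let G : Fin p → I → ℝ := fun i x => if h : i ∈ J then g ⟨i, h⟩ x else 1
  have h1 : ∀ x : Fin p → I, ∏ j : J, g j (x j) = ∏ i, G i (x i) := fun x => by
    rw [← Finset.prod_subset (Finset.subset_univ J), ← Finset.prod_attach J]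
    · exact Finset.prod_congr rfl fun j _ => by simp [G]
    · intro i _ hi; simp [G, hi]
  simp_rw [h1, designLaw]
  have h2 := integral_fintype_prod_eq_prod (𝕜 := ℝ) (μ := fun _ : Fin p => coordLaw μ) G
  refine h2.trans ?_
  rw [← Finset.prod_subset (Finset.subset_univ J), ← Finset.prod_attach J]
  · refine Finset.prod_congr rfl fun j _ => ?_
    rw [integral_realLaw μ (hg j)]
    simp [G]
  · intro i _ hi; simp [G, hi]

/-- The tensor products of `k` functions over the coordinates in `J`. -/
noncomputable def tensorFun (a : ℝ) {n k p : ℕ} (J : Finset (Fin p))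
    (e : Fin k → EuclideanSpace ℝ (Fin n)) (α : J → Fin k) (x : Fin p → I) : ℝ :=
  ∏ j : J, featureSum a (e (α j)) (x j)

theorem tensorFun_eq_sum (a : ℝ) {n k p : ℕ} (J : Finset (Fin p))
    (e : Fin k → EuclideanSpace ℝ (Fin n)) (α : J → Fin k) (x : Fin p → I) :
    tensorFun a J e α x =
      ∑ m : J → Fin n, (∏ j, e (α j) (m j)) * ∏ j : J, sqExpFeature a (m j) (x j) := by
  simp only [tensorFun, featureSum]
  rw [Finset.prod_univ_sum, Fintype.piFinset_univ]
  exact Finset.sum_congr rfl fun m _ => Finset.prod_mul_distrib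

theorem sum_tensor_coeff_sq {ι : Type*} [Fintype ι] [DecidableEq ι] {n k : ℕ}
    {e : Fin k → EuclideanSpace ℝ (Fin n)} (he : Orthonormal ℝ e) (c : (ι → Fin k) → ℝ) :
    ∑ m : ι → Fin n, (∑ α, c α * ∏ j, e (α j) (m j)) ^ 2 = ∑ α, c α ^ 2 := by
  have h1 : ∀ α β : ι → Fin k, ∑ m : ι → Fin n, (∏ j, e (α j) (m j)) * ∏ j, e (β j) (m j) =
      if α = β then 1 else 0 := fun α β => by
    simp_rw [← Finset.prod_mul_distrib]
    have := Finset.prod_univ_sum (fun _ : ι => (Finset.univ : Finset (Fin n)))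
      (fun j i => e (α j) i * e (β j) i)
    rw [Fintype.piFinset_univ] at this
    rw [← this]
    have h2 : ∀ j, ∑ i, e (α j) i * e (β j) i = if α j = β j then 1 else 0 := fun j => by
      rw [← orthonormal_iff_ite.1 he, PiLp.inner_apply]
      exact Finset.sum_congr rfl fun i _ => by simp [mul_comm]
    simp_rw [h2, Finset.prod_ite_zero, Finset.prod_const_one, funext_iff]
    simp
  simp_rw [sq, Finset.sum_mul_sum]
  rw [Finset.sum_comm]
  refine Finset.sum_congr rfl fun α _ => ?_
  rw [Finset.sum_comm]
  have h3 : ∀ β, ∑ m : ι → Fin n, c α * (∏ j, e (α j) (m j)) * (c β * ∏ j, e (β j) (m j)) =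
      c α * c β * if α = β then 1 else 0 := fun β => by
    rw [← h1, Finset.mul_sum]
    exact Finset.sum_congr rfl fun m _ => by ring
  simp_rw [h3]
  simp

theorem memLp_tensorFun {c₀ : ℝ} {μ : I → ℝ} (hμ : IsDesignDensity c₀ μ) (a : ℝ) {n k p : ℕ}
    (J : Finset (Fin p)) (e : Fin k → EuclideanSpace ℝ (Fin n)) (α : J → Fin k) :
    MemLp (tensorFun a J e α) 2 (designLaw μ p) := by
  have := hμ.isProbabilityMeasure_coordLaw
  have : IsProbabilityMeasure (designLaw μ p) :=
    inferInstanceAs (IsProbabilityMeasure (Measure.pi fun _ : Fin p => coordLaw μ))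
  have hc : Continuous (tensorFun a J e α) := by unfold tensorFun; fun_prop
  obtain ⟨C, hC⟩ := isCompact_univ.exists_bound_of_continuousOn hc.continuousOn
  exact MemLp.of_bound hc.aestronglyMeasurable C (ae_of_all _ fun x => hC x trivial)

/-- The `k^d` tensor products are orthogonal in `L²(μ^p)` with squared norms at least `l^d`, while
their coefficient tensors are orthonormal. The volumetric bound then applies with `s = √(l^d)`. -/
theorem ofReal_pow_le_designCoveringNumber {c₀ : ℝ} {μ : I → ℝ} (hμ : IsDesignDensity c₀ μ)
    {p : ℕ} (J : Finset (Fin p)) {a : ℝ} {k : ℕ} {l : ℝ} (hl : 0 < l)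
    (h : HasSpectralSubspace (realLaw μ) a k l) {ε : ℝ≥0} (hε : 0 < ε) :
    ENNReal.ofReal ((√(l ^ J.card) / ε) ^ k ^ J.card) ≤
      ((designCoveringNumber μ J a ε : ℕ∞) : ℝ≥0∞) := by
  have := hμ.isProbabilityMeasure_realLaw
  obtain ⟨n, e, he, horth, hle⟩ := h.exists_orthonormal (realLaw_compl_Icc μ)
  let G : (J → Fin k) → Lp ℝ 2 (designLaw μ p) := fun α => (memLp_tensorFun hμ a J e α).toLp _
  have hG : ∀ α, G α =ᵐ[designLaw μ p] tensorFun a J e α := fun α => MemLp.coeFn_toLp _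
  have hinner : ∀ α β, inner ℝ (G α) (G β) =
      ∏ j, ∫ x, featureSum a (e (α j)) x * featureSum a (e (β j)) x ∂(realLaw μ) := by
    intro α β
    rw [← integral_designLaw_prod hμ J
      (fun j x => featureSum a (e (α j)) x * featureSum a (e (β j)) x) (fun j => by fun_prop),
      L2.inner_def]
    refine integral_congr_ae ?_
    filter_upwards [hG α, hG β] with x hx hy
    rw [hx, hy]
    simp [tensorFun, Finset.prod_mul_distrib, mul_comm]
  have horthG : ∀ α β, α ≠ β → inner ℝ (G α) (G β) = 0 := fun α β hαβ => by
    obtain ⟨j, hj⟩ := Function.ne_iff.1 hαβ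
    rw [hinner]
    exact Finset.prod_eq_zero (Finset.mem_univ j) (horth _ _ hj)
  have hnormG : ∀ α, l ^ J.card ≤ inner ℝ (G α) (G α) := fun α => by
    rw [hinner]
    have : l ^ J.card = ∏ _j : J, l := by simp
    rw [this]
    refine Finset.prod_le_prod (fun _ _ => hl.le) fun j _ => ?_
    simpa [sq] using hle (α j)
  let T : EuclideanSpace ℝ (J → Fin k) →ₗ[ℝ] Lp ℝ 2 (designLaw μ p) :=
    ∑ α, (LinearMap.toSpanSingleton ℝ _ (G α)) ∘ₗ (EuclideanSpace.proj α).toLinearMap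
  have hT : ∀ c, T c = ∑ α, c α • G α := fun c => by simp [T]
  have hmain := ofReal_pow_le_externalCoveringNumber (A := designBall μ J a) T
    (s := √(l ^ J.card)) (by positivity) ?_ ?_ hε
  · rw [finrank_euclideanSpace] at hmain
    simpa [designCoveringNumber] using hmain
  · intro c
    rw [← sq_le_sq₀ (by positivity) (norm_nonneg _), mul_pow, Real.sq_sqrt (by positivity), hT,
      EuclideanSpace.norm_sq_eq, ← real_inner_self_eq_norm_sq, sum_inner, Finset.mul_sum]
    refine Finset.sum_le_sum fun α _ => ?_
    rw [inner_sum, Finset.sum_eq_single α]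
    · rw [inner_smul_left, inner_smul_right]
      have := hnormG α
      simp only [Real.norm_eq_abs, sq_abs, conj_trivial]
      nlinarith [sq_nonneg (c α)]
    · intro β _ hβ
      rw [inner_smul_left, inner_smul_right, horthG α β hβ.symm]
      simp
    · simp
  · intro c hc
    refine ⟨fun x : J → I => ∑ m : J → Fin n, (∑ α, c α * ∏ j, e (α j) (m j)) *
      ∏ j, sqExpFeature a (m j) (x j), ?_, ?_⟩
    · refine prod_feature_sum_mem_sqExpBall a n _ ?_
      rw [sum_tensor_coeff_sq he]
      have h1 : ‖c‖ ^ 2 ≤ 1 := by nlinarith [norm_nonneg c]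
      simpa [EuclideanSpace.norm_sq_eq] using h1
    · rw [hT]
      have h1 : (∑ α, c α • G α : Lp ℝ 2 (designLaw μ p)) =ᵐ[designLaw μ p]
          fun x => ∑ α, c α * tensorFun a J e α x := by
        have h2 : ∀ s : Finset (J → Fin k), ((∑ α ∈ s, c α • G α : Lp ℝ 2 (designLaw μ p)) :
            (Fin p → I) → ℝ) =ᵐ[designLaw μ p] fun x => ∑ α ∈ s, c α * tensorFun a J e α x := by
          intro s
          induction s using Finset.induction_on with
          | empty =>
            simp only [Finset.sum_empty]
            exact Lp.coeFn_zero ℝ 2 (designLaw μ p)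
          | insert α s hα ih =>
            rw [Finset.sum_insert hα]
            filter_upwards [Lp.coeFn_add (c α • G α) (∑ β ∈ s, c β • G β), ih, hG α,
              Lp.coeFn_smul (c α) (G α)] with x h1 h2 h3 h4
            rw [h1, Pi.add_apply, h2, h4, Pi.smul_apply, h3, Finset.sum_insert hα, smul_eq_mul]
        exact h2 Finset.univ
      filter_upwards [h1] with x hx
      rw [hx]
      simp_rw [tensorFun_eq_sum, Finset.mul_sum, Finset.sum_mul]
      rw [Finset.sum_comm]
      exact Finset.sum_congr rfl fun m _ => Finset.sum_congr rfl fun α _ => by ring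

theorem log_le_log_designCoveringNumber {c₀ : ℝ} {μ : I → ℝ} (hμ : IsDesignDensity c₀ μ)
    {p : ℕ} (J : Finset (Fin p)) {a : ℝ} {k : ℕ} {l : ℝ} (hl : 0 < l)
    (h : HasSpectralSubspace (realLaw μ) a k l) {ε : ℝ≥0} (hε : 0 < ε) :
    (((k : ℝ) ^ J.card * (J.card / 2 * Real.log l - Real.log ε) : ℝ) : EReal) ≤
      ENNReal.log ((designCoveringNumber μ J a ε : ℕ∞) : ℝ≥0∞) := by
  have hε' : (0 : ℝ) < ε := hε
  have h1 := ENNReal.log_monotone (ofReal_pow_le_designCoveringNumber hμ J hl h hε)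
  refine le_trans (le_of_eq ?_) h1
  rw [ENNReal.log_ofReal_of_pos (by positivity), Real.log_pow, Real.log_div (by positivity)
    (by positivity), Real.log_sqrt (by positivity), Real.log_pow, Nat.cast_pow]
  exact congrArg _ (by ring)

/-! ### Uniform approximation by the truncated kernel -/

theorem sqExpPartialKernel_nonneg (a : ℝ) (n : ℕ) {x y : ℝ} (hx : 0 ≤ x) (hy : 0 ≤ y) :
    0 ≤ sqExpPartialKernel a n x y := by
  refine Finset.sum_nonneg fun i _ => ?_
  rw [sqExpFeature_mul]
  positivity

theorem sqExpPartialKernel_le (a : ℝ) (n : ℕ) {x y : ℝ} (hx : 0 ≤ x) (hy : 0 ≤ y) :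
    sqExpPartialKernel a n x y ≤ Real.exp (-(a ^ 2 * (x - y) ^ 2)) := by
  rw [sqExpPartialKernel_eq_sum_range]
  refine sum_le_hasSum _ (fun i _ => ?_) (hasSum_sqExpFeature_mul a x y)
  rw [sqExpFeature_mul]
  positivity

/-- On the unit square `0 ≤ x y ≤ 1`, so the remainder is dominated, uniformly in `x` and `y`, by
the tail of the exponential series at `2 a²`. -/
theorem eventually_exp_sub_le_sqExpPartialKernel (a : ℝ) {δ : ℝ} (hδ : 0 < δ) :
    ∀ᶠ n in Filter.atTop, ∀ x ∈ Set.Icc (0 : ℝ) 1, ∀ y ∈ Set.Icc (0 : ℝ) 1,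
      Real.exp (-(a ^ 2 * (x - y) ^ 2)) - δ ≤ sqExpPartialKernel a n x y := by
  have hT : Summable fun i : ℕ => (2 * a ^ 2) ^ i / (i.factorial : ℝ) :=
    Real.summable_pow_div_factorial _
  filter_upwards [(tendsto_sum_nat_add fun i : ℕ => (2 * a ^ 2) ^ i / (i.factorial : ℝ)).eventually
    (gt_mem_nhds hδ)] with n hn x hx y hy
  have hs := hasSum_sqExpFeature_mul a x y
  have h1 := hs.summable.sum_add_tsum_nat_add n
  rw [hs.tsum_eq, ← sqExpPartialKernel_eq_sum_range] at h1
  have h2 : ∑' i, sqExpFeature a (i + n) x * sqExpFeature a (i + n) y ≤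
      ∑' i, (2 * a ^ 2) ^ (i + n) / ((i + n).factorial : ℝ) := by
    refine Summable.tsum_le_tsum (fun i => ?_) ((summable_nat_add_iff n).2 hs.summable)
      ((summable_nat_add_iff n).2 hT)
    rw [sqExpFeature_mul]
    have hxy : x * y ≤ 1 := mul_le_one₀ hx.2 hy.1 hy.2
    have hxy0 : 0 ≤ x * y := mul_nonneg hx.1 hy.1
    have h3 : Real.exp (-(a * x) ^ 2 - (a * y) ^ 2) ≤ 1 := by
      rw [Real.exp_le_one_iff]; nlinarith [sq_nonneg (a * x), sq_nonneg (a * y)]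
    have h4 : (2 * a ^ 2 * x * y) ^ (i + n) ≤ (2 * a ^ 2) ^ (i + n) := by
      have h5 : 2 * a ^ 2 * x * y = 2 * a ^ 2 * (x * y) := by ring
      rw [h5]
      refine pow_le_pow_left₀ (by positivity) ?_ _
      exact mul_le_of_le_one_right (by positivity) hxy
    have h6 : 0 ≤ 2 * a ^ 2 * x * y := by
      rw [mul_assoc]; positivity
    refine (mul_le_of_le_one_left (by positivity) h3).trans ?_
    gcongr
  linarith

/-! ### Dual description of spectral subspaces -/

theorem integrable_mul_of_bounded {ν : Measure ℝ} [IsFiniteMeasure ν]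
    (hν : ν (Set.Icc 0 1)ᶜ = 0) {f h : ℝ → ℝ} (hf : Continuous f) (hh : Measurable h) {M : ℝ}
    (hM : ∀ x, |h x| ≤ M) : Integrable (fun x => f x * h x) ν :=
  (integrable_of_continuous_of_Icc hν hf).mul_bdd (c := M) hh.aestronglyMeasurable (ae_of_all _ hM)

theorem ae_prod_mem_Icc {ν : Measure ℝ} [IsFiniteMeasure ν] (hν : ν (Set.Icc 0 1)ᶜ = 0) :
    ∀ᵐ z ∂(ν.prod ν), z.1 ∈ Set.Icc (0 : ℝ) 1 ∧ z.2 ∈ Set.Icc (0 : ℝ) 1 := by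
  have h1 : ∀ᵐ x ∂ν, x ∈ Set.Icc (0 : ℝ) 1 := hν
  exact (Measure.quasiMeasurePreserving_fst.ae h1).and (Measure.quasiMeasurePreserving_snd.ae h1)

theorem integrable_bounded_mul_prod {ν : Measure ℝ} [IsFiniteMeasure ν] {h : ℝ → ℝ}
    (hh : Measurable h) {M : ℝ} (hM : ∀ x, |h x| ≤ M) {k : ℝ × ℝ → ℝ} (hk : Measurable k) {B : ℝ}
    (hB : ∀ z, |k z| ≤ B) :
    Integrable (fun z : ℝ × ℝ => k z * (h z.1 * h z.2)) (ν.prod ν) := by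
  refine Integrable.of_bound (by fun_prop) (B * (M * M)) (ae_of_all _ fun z => ?_)
  rw [norm_mul, norm_mul]
  have hM0 : 0 ≤ M := (abs_nonneg _).trans (hM 0)
  have hB0 : 0 ≤ B := (abs_nonneg _).trans (hB 0)
  exact mul_le_mul (hB z) (mul_le_mul (hM _) (hM _) (abs_nonneg _) hM0) (by positivity) hB0

theorem integrable_sq_of_bounded {ν : Measure ℝ} [IsFiniteMeasure ν] {h : ℝ → ℝ}
    (hh : Measurable h) {M : ℝ} (hM : ∀ x, |h x| ≤ M) : Integrable (fun x => h x ^ 2) ν := by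
  refine Integrable.of_bound (by fun_prop) (M ^ 2) (ae_of_all _ fun x => ?_)
  rw [Real.norm_eq_abs, abs_pow]
  exact pow_le_pow_left₀ (abs_nonneg _) (hM x) 2

/-- A space of densities on which the kernel operator is bounded below by `l'` provides, for every
`l < l'`, a spectral subspace of the same dimension. -/
theorem hasSpectralSubspace_of_dual {ν : Measure ℝ} [IsFiniteMeasure ν]
    (hν : ν (Set.Icc 0 1)ᶜ = 0) {a l l' : ℝ} (hl : 0 < l) (hll : l < l') {k : ℕ}
    (H : (Fin k → ℝ) →ₗ[ℝ] (ℝ → ℝ)) (hmeas : ∀ c, Measurable (H c))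
    (hbdd : ∀ c, ∃ M, ∀ x, |H c x| ≤ M) (hpos : ∀ c, c ≠ 0 → 0 < ∫ x, H c x ^ 2 ∂ν)
    (hK : ∀ c, l' * ∫ x, H c x ^ 2 ∂ν ≤
      ∫ z : ℝ × ℝ, Real.exp (-(a ^ 2 * (z.1 - z.2) ^ 2)) * (H c z.1 * H c z.2) ∂(ν.prod ν)) :
    HasSpectralSubspace ν a k l := by
  set θ := ν.real Set.univ
  have hθ : 0 ≤ θ := measureReal_nonneg
  obtain ⟨n, hn⟩ := (eventually_exp_sub_le_sqExpPartialKernel a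
    (δ := (l' - l) / (θ + 1)) (by have := sub_pos.2 hll; positivity)).exists
  set δ := (l' - l) / (θ + 1) with hδ
  have hδ0 : 0 ≤ δ := by have := sub_pos.2 hll; positivity
  have hδθ : δ * θ ≤ l' - l := by
    rw [hδ, div_mul_eq_mul_div, div_le_iff₀ (by positivity)]
    nlinarith
  have hint : ∀ (i : ℕ) c, Integrable (fun x => sqExpFeature a i x * H c x) ν := fun i c => by
    obtain ⟨M, hM⟩ := hbdd c
    exact integrable_mul_of_bounded hν (by fun_prop) (hmeas c) hM
  -- `W` is the adjoint of `v ↦ featureSum a v`, applied to the density `H c`. Hence `‖W c‖²` is the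
  -- energy of `H c` for the truncated kernel, which is within `δ θ ≤ l' - l` times `∫ (H c)²` of
  -- the full energy.
  let W : (Fin k → ℝ) →ₗ[ℝ] EuclideanSpace ℝ (Fin n) :=
    { toFun := fun c => WithLp.toLp 2 fun i => ∫ x, sqExpFeature a i x * H c x ∂ν
      map_add' := fun c c' => by
        ext i
        simp only [map_add, Pi.add_apply, mul_add, PiLp.add_apply]
        exact integral_add (hint _ _) (hint _ _)
      map_smul' := fun t c => by
        ext i
        simp only [map_smul, Pi.smul_apply, smul_eq_mul, RingHom.id_apply, PiLp.smul_apply]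
        rw [← integral_const_mul]
        exact integral_congr_ae (ae_of_all _ fun x => by ring) }
  have hW : ∀ c i, W c i = ∫ x, sqExpFeature a i x * H c x ∂ν := fun c i => rfl
  have hnorm : ∀ c, ‖W c‖ ^ 2 =
      ∫ z : ℝ × ℝ, sqExpPartialKernel a n z.1 z.2 * (H c z.1 * H c z.2) ∂(ν.prod ν) := by
    intro c
    have h1 : ∀ z : ℝ × ℝ, sqExpPartialKernel a n z.1 z.2 * (H c z.1 * H c z.2) =
        ∑ i : Fin n, (sqExpFeature a i z.1 * H c z.1) * (sqExpFeature a i z.2 * H c z.2) :=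
      fun z => by
        rw [sqExpPartialKernel, Finset.sum_mul]
        exact Finset.sum_congr rfl fun i _ => by ring
    simp_rw [h1]
    rw [integral_finsetSum _ fun (i : Fin n) _ => (hint i c).mul_prod (hint i c), EuclideanSpace.norm_sq_eq]
    refine Finset.sum_congr rfl fun i _ => ?_
    rw [integral_prod_mul (fun x => sqExpFeature a i x * H c x)
      (fun x => sqExpFeature a i x * H c x), hW, Real.norm_eq_abs, sq_abs, sq]
  have hlow : ∀ c, l * ∫ x, H c x ^ 2 ∂ν ≤ ‖W c‖ ^ 2 := by
    intro c
    obtain ⟨M, hM⟩ := hbdd c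
    have hsq := integrable_sq_of_bounded (ν := ν) (hmeas c) hM
    have hi1 := integrable_bounded_mul_prod (ν := ν) (hmeas c) hM
      (k := fun z => Real.exp (-(a ^ 2 * (z.1 - z.2) ^ 2))) (by fun_prop) (B := 1) (fun z => by
        rw [abs_of_pos (Real.exp_pos _), Real.exp_le_one_iff]
        exact neg_nonpos.2 (by positivity))
    have hi2 : Integrable (fun z : ℝ × ℝ => sqExpPartialKernel a n z.1 z.2 * (H c z.1 * H c z.2))
        (ν.prod ν) := by
      have h1 : ∀ z : ℝ × ℝ, sqExpPartialKernel a n z.1 z.2 * (H c z.1 * H c z.2) =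
          ∑ i : Fin n, (sqExpFeature a i z.1 * H c z.1) * (sqExpFeature a i z.2 * H c z.2) :=
        fun z => by
          rw [sqExpPartialKernel, Finset.sum_mul]
          exact Finset.sum_congr rfl fun i _ => by ring
      simp_rw [h1]
      exact integrable_finsetSum _ fun i _ => (hint i c).mul_prod (hint i c)
    have hi3 : Integrable (fun z : ℝ × ℝ => δ * ((H c z.1 ^ 2 + H c z.2 ^ 2) / 2)) (ν.prod ν) :=
      (((hsq.comp_fst ν).add (hsq.comp_snd ν)).div_const 2).const_mul δ
    have hbound : ∫ z : ℝ × ℝ, Real.exp (-(a ^ 2 * (z.1 - z.2) ^ 2)) * (H c z.1 * H c z.2)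
        ∂(ν.prod ν) - ‖W c‖ ^ 2 ≤ ∫ z : ℝ × ℝ, δ * ((H c z.1 ^ 2 + H c z.2 ^ 2) / 2) ∂(ν.prod ν) := by
      rw [hnorm, ← integral_sub hi1 hi2]
      refine integral_mono_ae (hi1.sub hi2) hi3 ?_
      filter_upwards [ae_prod_mem_Icc hν] with z hz
      have h1 := hn z.1 hz.1 z.2 hz.2
      have h2 := sqExpPartialKernel_le a n hz.1.1 hz.2.1
      simp only [← sub_mul]
      set D := Real.exp (-(a ^ 2 * (z.1 - z.2) ^ 2)) - sqExpPartialKernel a n z.1 z.2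
      have hD0 : 0 ≤ D := sub_nonneg.2 h2
      have hD1 : D ≤ δ := by simp only [D]; linarith
      have h3 : H c z.1 * H c z.2 ≤ (H c z.1 ^ 2 + H c z.2 ^ 2) / 2 := by
        nlinarith [sq_nonneg (H c z.1 - H c z.2)]
      have h4 : 0 ≤ (H c z.1 ^ 2 + H c z.2 ^ 2) / 2 := by positivity
      exact (mul_le_mul_of_nonneg_left h3 hD0).trans (mul_le_mul_of_nonneg_right hD1 h4)
    have hval : ∫ z : ℝ × ℝ, δ * ((H c z.1 ^ 2 + H c z.2 ^ 2) / 2) ∂(ν.prod ν) =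
        δ * θ * ∫ x, H c x ^ 2 ∂ν := by
      rw [integral_const_mul, integral_div, integral_add (hsq.comp_fst ν) (hsq.comp_snd ν),
        integral_fun_fst (fun x => H c x ^ 2), integral_fun_snd (fun x => H c x ^ 2)]
      simp only [smul_eq_mul]
      ring
    have h0 : 0 ≤ ∫ x, H c x ^ 2 ∂ν := integral_nonneg fun x => sq_nonneg _
    have := hK c
    nlinarith
  have hinj : LinearMap.ker W = ⊥ := by
    rw [LinearMap.ker_eq_bot']
    intro c hc
    by_contra hne
    have h1 := hlow c
    rw [hc] at h1
    have := mul_pos hl (hpos c hne)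
    simp at h1
    linarith
  refine ⟨n, LinearMap.range W, ?_, ?_⟩
  · rw [LinearMap.finrank_range_of_inj (LinearMap.ker_eq_bot.1 hinj)]
    simp
  · rintro _ ⟨c, rfl⟩
    rcases eq_or_ne c 0 with rfl | hc
    · simp [featureSum]
    have hh := hpos c hc
    obtain ⟨M, hM⟩ := hbdd c
    have hsq := integrable_sq_of_bounded (ν := ν) (hmeas c) hM
    have hf : Continuous (featureSum a (W c)) := by fun_prop
    set Q := ∫ x, H c x ^ 2 ∂ν
    have hcross : ∫ x, featureSum a (W c) x * H c x ∂ν = ‖W c‖ ^ 2 := by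
      simp_rw [featureSum, Finset.sum_mul, mul_assoc]
      rw [integral_finsetSum _ fun (i : Fin n) _ => (hint i c).const_mul _, EuclideanSpace.norm_sq_eq]
      refine Finset.sum_congr rfl fun i _ => ?_
      rw [integral_const_mul, ← hW, Real.norm_eq_abs, sq_abs, sq]
    have hi1 : Integrable (fun x => featureSum a (W c) x ^ 2) ν :=
      integrable_of_continuous_of_Icc hν (by fun_prop)
    have hi2 := integrable_mul_of_bounded hν hf (hmeas c) hM
    -- The minimiser of `∫ (f - t h)²` with `f = featureSum a (W c)` and `h = H c`. Nonnegativity of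
    -- the minimum is Cauchy–Schwarz, `∫ f² ≥ ‖W c‖⁴ / Q = t ‖W c‖²`, and `t ≥ l`.
    set t := ‖W c‖ ^ 2 / Q
    have h0 : 0 ≤ ∫ x, (featureSum a (W c) x - t * H c x) ^ 2 ∂ν :=
      integral_nonneg fun x => sq_nonneg _
    have h1 : ∫ x, (featureSum a (W c) x - t * H c x) ^ 2 ∂ν =
        ∫ x, featureSum a (W c) x ^ 2 ∂ν - 2 * t * ‖W c‖ ^ 2 + t ^ 2 * Q := by
      have hd : Integrable (fun x => featureSum a (W c) x ^ 2 -
          2 * t * (featureSum a (W c) x * H c x)) ν := hi1.sub (hi2.const_mul _)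
      rw [← hcross, ← integral_const_mul, ← integral_const_mul, ← integral_sub hi1 (hi2.const_mul _),
        ← integral_add hd (hsq.const_mul _)]
      exact integral_congr_ae (ae_of_all _ fun x => by ring)
    have h2 : t * Q = ‖W c‖ ^ 2 := div_mul_cancel₀ _ hh.ne'
    have h3 : l ≤ t := by rw [le_div_iff₀ hh]; exact hlow c
    have h4 : l * ‖W c‖ ^ 2 ≤ t * ‖W c‖ ^ 2 := mul_le_mul_of_nonneg_right h3 (sq_nonneg _)
    rw [h1] at h0
    nlinarith

/-! ### Lower bounds for the Gaussian energy -/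

/-- Compares the Gaussian with a tent. The half-width `1.51` must exceed `√2` for the
Hilbert–Schmidt estimate and must give `1.51 / (a + 1.51) > 1 / a` for all `a ≥ 3`. -/
theorem one_sub_div_le_exp_neg_sq {u : ℝ} (hu : 0 ≤ u) : 1 - u / 1.51 ≤ Real.exp (-u ^ 2) := by
  rcases le_or_gt 1.51 u with h1 | h1
  · have : 1 - u / 1.51 ≤ 0 := by rw [sub_nonpos, le_div_iff₀ (by norm_num)]; linarith
    exact this.trans (Real.exp_pos _).le
  rcases le_or_gt u 0.662 with h2 | h2
  · have h3 := Real.add_one_le_exp (-u ^ 2)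
    have h4 := mul_nonneg hu (sub_nonneg.2 h2)
    have h5 : 1 - u / 1.51 ≤ 1 - 0.662 * u := by
      rw [sub_le_sub_iff_left, le_div_iff₀ (by norm_num)]; linarith
    linarith
  have he : (0.2865 : ℝ) ≤ Real.exp (-1.25) := by
    have h4 : Real.exp 1.25 ^ 4 ≤ 3.4904 ^ 4 := by
      rw [← Real.exp_nat_mul]
      have h5 : Real.exp ((4 : ℕ) * 1.25) = Real.exp 1 ^ 5 := by
        rw [← Real.exp_nat_mul]; norm_num
      rw [h5]
      calc Real.exp 1 ^ 5 ≤ 2.7182818286 ^ 5 :=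
            pow_le_pow_left₀ (Real.exp_pos _).le Real.exp_one_lt_d9.le _
        _ ≤ 3.4904 ^ 4 := by norm_num
    have h6 : Real.exp 1.25 ≤ 3.4904 := le_of_pow_le_pow_left₀ (by norm_num) (by norm_num) h4
    rw [Real.exp_neg, le_inv_comm₀ (by norm_num) (Real.exp_pos _)]
    exact h6.trans (by norm_num)
  -- The inequality is tightest near `u² = 1.25`, so `exp` is expanded there. Squaring `1 + x/2 ≤
  -- exp (x/2)` is sharper than `1 + x ≤ exp x`.
  have hw : (1.625 - u ^ 2 / 2) ^ 2 ≤ Real.exp (1.25 - u ^ 2) := by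
    have h7 : Real.exp (1.25 - u ^ 2) = Real.exp ((1.25 - u ^ 2) / 2) ^ 2 := by
      rw [← Real.exp_nat_mul]; congr 1; push_cast; ring
    rw [h7]
    have h8 := Real.add_one_le_exp ((1.25 - u ^ 2) / 2)
    refine pow_le_pow_left₀ (by nlinarith) (by linarith) 2
  have h9 : Real.exp (-u ^ 2) = Real.exp (-1.25) * Real.exp (1.25 - u ^ 2) := by
    rw [← Real.exp_add]; congr 1; ring
  rw [h9]
  have h10 : 0.2865 * (1.625 - u ^ 2 / 2) ^ 2 ≤ Real.exp (-1.25) * Real.exp (1.25 - u ^ 2) :=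
    mul_le_mul he hw (sq_nonneg _) (Real.exp_pos _).le
  refine le_trans ?_ h10
  have h12 : 1 - u / 1.51 ≤ 1 - 0.662 * u := by
    rw [sub_le_sub_iff_left, le_div_iff₀ (by norm_num)]; linarith
  refine h12.trans ?_
  rcases le_or_gt u 1.05 with h11 | h11
  · have h13 := mul_nonneg (sub_nonneg.2 h2.le) (sub_nonneg.2 h11)
    nlinarith [mul_nonneg h13 hu, mul_nonneg h13 (sq_nonneg u)]
  · obtain ⟨x, rfl⟩ : ∃ x, u = 1.05 + x := ⟨u - 1.05, by ring⟩
    have hx : 0 ≤ x := by linarith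
    nlinarith [pow_nonneg hx 2, pow_nonneg hx 3, pow_nonneg hx 4]

/-- The tent is an autocorrelation: with `g z` the `ν`-mass of `[z - r, z)`, one has `∫ g² = r ∬
tent` and `∫ g = θ r`. As `g` is carried by an interval of length `1 + r`, Cauchy–Schwarz gives the
bound for every `ν`. Here `t` is the mean of `g`. -/
theorem triangle_energy_lower_bound {ν : Measure ℝ} [IsFiniteMeasure ν]
    (hν : ν (Set.Icc 0 1)ᶜ = 0) {r : ℝ} (hr : 0 < r) :
    ν.real Set.univ ^ 2 * (r / (1 + r)) ≤ ∫ z : ℝ × ℝ, max 0 (1 - |z.1 - z.2| / r) ∂(ν.prod ν) := by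
  set θ := ν.real Set.univ
  let lam : Measure ℝ := volume.restrict (Set.Icc 0 (1 + r))
  let w : ℝ → ℝ → ℝ := fun x z => if x < z ∧ z ≤ x + r then 1 else 0
  have hwm : Measurable (fun p : ℝ × ℝ => w p.1 p.2) := by
    refine Measurable.ite ?_ measurable_const measurable_const
    exact (measurableSet_lt measurable_fst measurable_snd).inter
      (measurableSet_le measurable_snd (by fun_prop))
  have hw1 : ∀ x z, |w x z| ≤ 1 := fun x z => by
    simp only [w]; split_ifs <;> simp
  have hcomp : ∀ {α : Type} [MeasurableSpace α] {f g : α → ℝ}, Measurable f → Measurable g →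
      Measurable fun p => w (f p) (g p) := fun hf hg => hwm.comp (hf.prodMk hg)
  let g : ℝ → ℝ := fun z => ∫ x, w x z ∂ν
  have hlam : lam.real Set.univ = 1 + r := by
    simp only [lam, measureReal_restrict_apply_univ, Real.volume_real_Icc]
    rw [max_eq_left (by linarith)]; ring
  have hi1 : Integrable (fun p : ℝ × ℝ => w p.2 p.1) (lam.prod ν) :=
    Integrable.of_bound (hcomp measurable_snd measurable_fst).aestronglyMeasurable 1
      (ae_of_all _ fun p => hw1 _ _)
  have hi2 : Integrable (fun p : ℝ × (ℝ × ℝ) => w p.2.1 p.1 * w p.2.2 p.1)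
      (lam.prod (ν.prod ν)) := by
    refine Integrable.of_bound ((hcomp (by fun_prop) (by fun_prop)).mul
      (hcomp (by fun_prop) (by fun_prop))).aestronglyMeasurable 1 (ae_of_all _ fun p => ?_)
    rw [norm_mul]
    exact mul_le_one₀ (hw1 _ _) (abs_nonneg _) (hw1 _ _)
  have hgsq : ∀ z, g z ^ 2 = ∫ p : ℝ × ℝ, w p.1 z * w p.2 z ∂(ν.prod ν) := fun z => by
    rw [integral_prod_mul (fun x => w x z) (fun x => w x z), sq]
  have hG : ∫ z, g z ∂lam = θ * r := by
    have h1 : ∫ z, g z ∂lam = ∫ x, ∫ z, w x z ∂lam ∂ν :=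
      integral_integral_swap (f := fun z x => w x z) hi1
    have h2 : ∀ᵐ x ∂ν, ∫ z, w x z ∂lam = r := by
      have h3 : ∀ᵐ x ∂ν, x ∈ Set.Icc (0 : ℝ) 1 := hν
      filter_upwards [h3] with x hx
      have h4 : (fun z => w x z) = (Set.Ioc x (x + r)).indicator 1 := by
        ext z; simp [w, Set.indicator_apply]
      have hsub : Set.Ioc x (x + r) ⊆ Set.Icc 0 (1 + r) := fun z hz =>
        ⟨hx.1.trans hz.1.le, by linarith [hz.2, hx.2]⟩
      rw [h4, integral_indicator_one measurableSet_Ioc, measureReal_restrict_apply measurableSet_Ioc,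
        Set.inter_eq_left.2 hsub,
        Real.volume_real_Ioc_of_le (by linarith)]
      ring
    rw [h1, integral_congr_ae h2, integral_const, smul_eq_mul]
  have hG2 : ∫ z, g z ^ 2 ∂lam =
      ∫ p : ℝ × ℝ, r * max 0 (1 - |p.1 - p.2| / r) ∂(ν.prod ν) := by
    simp_rw [hgsq]
    have h1 := integral_integral_swap (f := fun z (p : ℝ × ℝ) => w p.1 z * w p.2 z) hi2
    rw [h1]
    refine integral_congr_ae ?_
    filter_upwards [ae_prod_mem_Icc hν] with p hp
    obtain ⟨x, y⟩ := p
    simp only at hp ⊢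
    have h4 : (fun z => w x z * w y z) = (Set.Ioc (max x y) (min x y + r)).indicator 1 := by
      ext z
      simp only [w, Set.indicator_apply, Set.mem_Ioc, max_lt_iff, Pi.one_apply]
      have : z ≤ min x y + r ↔ z ≤ x + r ∧ z ≤ y + r := by
        rw [← sub_le_iff_le_add, le_min_iff, sub_le_iff_le_add, sub_le_iff_le_add]
      simp only [this]
      by_cases h1 : x < z <;> by_cases h2 : y < z <;> by_cases h3 : z ≤ x + r <;>
        by_cases h4 : z ≤ y + r <;> simp [h1, h2, h3, h4]
    have hsub : Set.Ioc (max x y) (min x y + r) ⊆ Set.Icc 0 (1 + r) := fun z hz =>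
      ⟨(hp.1.1.trans (le_max_left _ _)).trans hz.1.le, by linarith [hz.2, hp.1.2, min_le_left x y]⟩
    rw [h4, integral_indicator_one measurableSet_Ioc, measureReal_restrict_apply measurableSet_Ioc,
      Set.inter_eq_left.2 hsub, Real.volume_real_Ioc]
    have h5 : min x y + r - max x y = r * (1 - |x - y| / r) := by
      rw [mul_sub, mul_div_cancel₀ _ hr.ne', ← max_sub_min_eq_abs,
        max_comm y x, min_comm y x]; ring
    rw [h5, max_comm, mul_max_of_nonneg _ _ hr.le, mul_zero]
  have hgi : Integrable g lam := hi1.integral_prod_left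
  have hg2i : Integrable (fun z => g z ^ 2) lam := by
    simp_rw [hgsq]; exact hi2.integral_prod_left
  set t := θ * r / (1 + r)
  have h0 : 0 ≤ ∫ z, (g z - t) ^ 2 ∂lam := integral_nonneg fun _ => sq_nonneg _
  have h1 : ∫ z, (g z - t) ^ 2 ∂lam = ∫ z, g z ^ 2 ∂lam - 2 * t * (θ * r) + t ^ 2 * (1 + r) := by
    have hd : Integrable (fun z => g z ^ 2 - 2 * t * g z) lam := hg2i.sub (hgi.const_mul _)
    have hc : ∫ _z, t ^ 2 ∂lam = t ^ 2 * (1 + r) := by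
      rw [integral_const, hlam, smul_eq_mul, mul_comm]
    rw [← hG, ← hc, ← integral_const_mul, ← integral_sub hg2i (hgi.const_mul _),
      ← integral_add hd (integrable_const _)]
    exact integral_congr_ae (ae_of_all _ fun z => by ring)
  rw [h1, hG2, integral_const_mul] at h0
  have h2 : t * (1 + r) = θ * r := div_mul_cancel₀ _ (by positivity)
  have h3 : t * (θ * r) = r * (θ ^ 2 * (r / (1 + r))) := by simp only [t]; ring
  have h4 : r * (θ ^ 2 * (r / (1 + r))) ≤
      r * ∫ z : ℝ × ℝ, max 0 (1 - |z.1 - z.2| / r) ∂(ν.prod ν) := by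
    have h5 : t ^ 2 * (1 + r) = t * (θ * r) := by rw [sq, mul_assoc, h2]
    linarith
  exact le_of_mul_le_mul_left h4 hr

theorem integrable_gaussian_prod (ν ν' : Measure ℝ) [IsFiniteMeasure ν] [IsFiniteMeasure ν']
    (b : ℝ) : Integrable (fun z : ℝ × ℝ => Real.exp (-(b ^ 2 * (z.1 - z.2) ^ 2))) (ν.prod ν') := by
  refine Integrable.of_bound (by fun_prop) 1 (ae_of_all _ fun z => ?_)
  rw [Real.norm_eq_abs, abs_of_pos (Real.exp_pos _), Real.exp_le_one_iff]
  exact neg_nonpos.2 (by positivity)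

theorem max_triangle_le_exp {b : ℝ} (hb : 0 < b) (x y : ℝ) :
    max 0 (1 - |x - y| / (1.51 / b)) ≤ Real.exp (-(b ^ 2 * (x - y) ^ 2)) := by
  refine max_le (Real.exp_pos _).le ?_
  have h := one_sub_div_le_exp_neg_sq (u := b * |x - y|) (by positivity)
  rw [mul_pow, sq_abs] at h
  refine le_trans (le_of_eq ?_) h
  field_simp

theorem gaussian_energy_lower_bound {ν : Measure ℝ} [IsFiniteMeasure ν]
    (hν : ν (Set.Icc 0 1)ᶜ = 0) {b : ℝ} (hb : 0 < b) :
    ν.real Set.univ ^ 2 * (1.51 / (b + 1.51)) ≤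
      ∫ z : ℝ × ℝ, Real.exp (-(b ^ 2 * (z.1 - z.2) ^ 2)) ∂(ν.prod ν) := by
  have h1 := triangle_energy_lower_bound hν (r := 1.51 / b) (by positivity)
  have h2 : 1.51 / b / (1 + 1.51 / b) = 1.51 / (b + 1.51) := by field_simp
  rw [h2] at h1
  refine h1.trans (integral_mono_of_nonneg (ae_of_all _ fun z => le_max_left _ _)
    (integrable_gaussian_prod ν ν b) (ae_of_all _ fun z => max_triangle_le_exp hb _ _))

/-- The constant density provides a one-dimensional spectral subspace. -/
theorem hasSpectralSubspace_one {ν : Measure ℝ} [IsProbabilityMeasure ν]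
    (hν : ν (Set.Icc 0 1)ᶜ = 0) {a l : ℝ} (hl : 0 < l)
    (h : l < ∫ z : ℝ × ℝ, Real.exp (-(a ^ 2 * (z.1 - z.2) ^ 2)) ∂(ν.prod ν)) :
    HasSpectralSubspace ν a 1 l := by
  refine hasSpectralSubspace_of_dual hν hl h
    (LinearMap.pi fun _ => LinearMap.proj 0 : (Fin 1 → ℝ) →ₗ[ℝ] (ℝ → ℝ)) ?_ ?_ ?_ ?_
  · intro c
    exact measurable_const
  · intro c
    exact ⟨|c 0|, fun x => le_rfl⟩
  · intro c hc
    have : c 0 ≠ 0 := fun h0 => hc (by ext i; rw [Subsingleton.elim i 0, h0]; rfl)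
    simp only [LinearMap.pi_apply, LinearMap.proj_apply, integral_const, probReal_univ, one_smul]
    positivity
  · intro c
    simp only [LinearMap.pi_apply, LinearMap.proj_apply, integral_const, probReal_univ, one_smul,
      integral_mul_const]
    rw [sq (c 0)]

/-- The energy of the constant density exceeds `1 / a` as soon as `0.51 a > 1.51`, whatever the
measure; the threshold is just below `3`. -/
theorem hasSpectralSubspace_one_of_three_le {ν : Measure ℝ} [IsProbabilityMeasure ν]
    (hν : ν (Set.Icc 0 1)ᶜ = 0) {a : ℝ} (ha : 3 ≤ a) : HasSpectralSubspace ν a 1 (1 / a) := by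
  refine hasSpectralSubspace_one hν (by positivity) ?_
  have h := gaussian_energy_lower_bound hν (b := a) (by linarith)
  rw [probReal_univ, one_pow, one_mul] at h
  refine lt_of_lt_of_le ?_ h
  rw [div_lt_div_iff₀ (by linarith) (by linarith)]
  linarith

/-! ### Lebesgue measure on the unit interval -/

/-- Lebesgue measure on the unit interval, as a measure on the real line. -/
noncomputable def unitLebesgue : Measure ℝ := volume.restrict (Set.Icc 0 1)

instance isProbabilityMeasure_unitLebesgue : IsProbabilityMeasure unitLebesgue :=
  ⟨by simp [unitLebesgue]⟩

theorem unitLebesgue_compl_Icc : unitLebesgue (Set.Icc 0 1)ᶜ = 0 := by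
  rw [unitLebesgue, Measure.restrict_apply measurableSet_Icc.compl]
  simp

theorem integral_unitLebesgue (f : ℝ → ℝ) : ∫ x, f x ∂unitLebesgue = ∫ x in (0 : ℝ)..1, f x := by
  rw [unitLebesgue, integral_Icc_eq_integral_Ioc, intervalIntegral.integral_of_le zero_le_one]

theorem map_coe_volume_unitInterval :
    (volume : Measure I).map (fun x : I => (x : ℝ)) = unitLebesgue :=
  (MeasurableEmbedding.subtype_coe measurableSet_Icc).map_comap volume |>.trans
    (by rw [Subtype.range_coe]; rfl)

theorem smul_unitLebesgue_le_realLaw {c₀ : ℝ} {μ : I → ℝ} (hμ : IsDesignDensity c₀ μ) :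
    ENNReal.ofReal c₀ • unitLebesgue ≤ realLaw μ := by
  rw [← map_coe_volume_unitInterval, realLaw, ← Measure.map_smul]
  refine Measure.map_mono ?_ (by fun_prop)
  rw [coordLaw, ← withDensity_const]
  exact withDensity_mono (ae_of_all _ fun x => ENNReal.ofReal_le_ofReal (hμ.lower_bound x))

theorem HasSpectralSubspace.of_unitLebesgue {c₀ : ℝ} (hc₀ : 0 < c₀) {μ : I → ℝ}
    (hμ : IsDesignDensity c₀ μ) {a : ℝ} {k : ℕ} {l : ℝ}
    (h : HasSpectralSubspace unitLebesgue a k l) : HasSpectralSubspace (realLaw μ) a k (c₀ * l) :=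
  have := hμ.isProbabilityMeasure_realLaw
  (h.smul_measure hc₀.le).mono_measure (smul_unitLebesgue_le_realLaw hμ) (realLaw_compl_Icc μ)

theorem integral_abs_sub_unitLebesgue :
    ∫ z : ℝ × ℝ, |z.1 - z.2| ∂(unitLebesgue.prod unitLebesgue) = 1 / 3 := by
  have hint : Integrable (fun z : ℝ × ℝ => |z.1 - z.2|) (unitLebesgue.prod unitLebesgue) := by
    refine Integrable.of_bound (by fun_prop) 1 ?_
    filter_upwards [ae_prod_mem_Icc unitLebesgue_compl_Icc] with z hz
    rw [Real.norm_eq_abs, abs_abs, abs_le]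
    constructor <;> linarith [hz.1.1, hz.1.2, hz.2.1, hz.2.2]
  rw [integral_prod _ hint]
  have h1 : ∀ᵐ x ∂unitLebesgue, ∫ y, |x - y| ∂unitLebesgue = x ^ 2 / 2 + (1 - x) ^ 2 / 2 := by
    have h2 : ∀ᵐ x ∂unitLebesgue, x ∈ Set.Icc (0 : ℝ) 1 := unitLebesgue_compl_Icc
    filter_upwards [h2] with x hx
    have hii : ∀ u v : ℝ, IntervalIntegrable (fun y => |x - y|) volume u v := fun u v =>
      Continuous.intervalIntegrable (by fun_prop) _ _
    rw [integral_unitLebesgue, ← intervalIntegral.integral_add_adjacent_intervals (hii 0 x) (hii x 1)]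
    have h3 : ∫ y in (0 : ℝ)..x, |x - y| = ∫ y in (0 : ℝ)..x, (x - y) := by
      refine intervalIntegral.integral_congr fun y hy => ?_
      rw [Set.uIcc_of_le hx.1] at hy
      exact abs_of_nonneg (by linarith [hy.2])
    have h4 : ∫ y in x..1, |x - y| = ∫ y in x..1, (y - x) := by
      refine intervalIntegral.integral_congr fun y hy => ?_
      rw [Set.uIcc_of_le hx.2] at hy
      rw [abs_of_nonpos (by linarith [hy.1])]; ring
    rw [h3, h4, intervalIntegral.integral_sub (by simp) (by simp),
      intervalIntegral.integral_sub (by simp) (by simp)]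
    simp only [intervalIntegral.integral_const, integral_id, smul_eq_mul]
    ring
  rw [integral_congr_ae h1, integral_unitLebesgue]
  have h5 : ∀ x : ℝ, x ^ 2 / 2 + (1 - x) ^ 2 / 2 = x ^ 2 - x + 1 / 2 := fun x => by ring
  simp_rw [h5]
  rw [intervalIntegral.integral_add (Continuous.intervalIntegrable (by fun_prop) _ _) (by simp),
    intervalIntegral.integral_sub (Continuous.intervalIntegrable (by fun_prop) _ _) (by simp)]
  simp only [integral_pow, integral_id, intervalIntegral.integral_const, smul_eq_mul]
  norm_num

/-- Below `3` the bound valid for all measures can fail to reach `1 / a`. For Lebesgue measure the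
mean distance is `1 / 3`, and `1 - a / (3 · 1.51) > 1 / a` on all of `[2, 3]`. -/
theorem hasSpectralSubspace_unitLebesgue_one {a : ℝ} (ha : 2 ≤ a) (ha3 : a ≤ 3) :
    HasSpectralSubspace unitLebesgue a 1 (1 / a) := by
  refine hasSpectralSubspace_one unitLebesgue_compl_Icc (by positivity) ?_
  have hint : Integrable (fun z : ℝ × ℝ => |z.1 - z.2|) (unitLebesgue.prod unitLebesgue) := by
    -- The integral of a non-integrable function is `0` by convention, which contradicts the value
    -- `1 / 3`.
    by_contra h
    have := integral_abs_sub_unitLebesgue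
    rw [integral_undef h] at this
    norm_num at this
  have h1 : ∫ z : ℝ × ℝ, (1 - a / 1.51 * |z.1 - z.2|) ∂(unitLebesgue.prod unitLebesgue) ≤
      ∫ z : ℝ × ℝ, Real.exp (-(a ^ 2 * (z.1 - z.2) ^ 2)) ∂(unitLebesgue.prod unitLebesgue) := by
    refine integral_mono ((integrable_const _).sub (hint.const_mul _))
      (integrable_gaussian_prod _ _ a) fun z => ?_
    refine le_trans (le_trans (le_of_eq ?_) (le_max_right _ _))
      (max_triangle_le_exp (by linarith : 0 < a) z.1 z.2)
    field_simp
  rw [integral_sub (integrable_const _) (hint.const_mul _), integral_const_mul,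
    integral_abs_sub_unitLebesgue, integral_const, probReal_univ, one_smul] at h1
  refine lt_of_lt_of_le ?_ h1
  rw [div_lt_iff₀ (by linarith)]
  have h2 : (1 - a / 1.51 * (1 / 3)) * a = a - a ^ 2 * (100 / 453) := by ring
  have h3 := mul_nonneg (sub_nonneg.2 ha) (sub_nonneg.2 ha3)
  rw [h2]
  nlinarith

/-! ### Counting large eigenvalues -/

/-- Parseval for the vector of Taylor features: the truncated kernel expands the same way in any
orthonormal basis, in particular in an eigenbasis. -/
theorem sqExpPartialKernel_eq_sum_featureSum (a : ℝ) {n : ℕ}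
    (e : OrthonormalBasis (Fin n) ℝ (EuclideanSpace ℝ (Fin n))) (x y : ℝ) :
    sqExpPartialKernel a n x y = ∑ i, featureSum a (e i) x * featureSum a (e i) y := by
  let Φ : ℝ → EuclideanSpace ℝ (Fin n) := fun t => WithLp.toLp 2 fun i => sqExpFeature a i t
  have h1 : ∀ (v : EuclideanSpace ℝ (Fin n)) t, featureSum a v t = inner ℝ v (Φ t) := fun v t => by
    rw [PiLp.inner_apply, featureSum]
    exact Finset.sum_congr rfl fun i _ => by simp [Φ, mul_comm]
  have h2 : sqExpPartialKernel a n x y = inner ℝ (Φ x) (Φ y) := by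
    rw [PiLp.inner_apply, sqExpPartialKernel]
    exact Finset.sum_congr rfl fun i _ => by simp [Φ, mul_comm]
  rw [h2, ← e.sum_inner_mul_inner]
  refine Finset.sum_congr rfl fun i _ => ?_
  rw [h1, h1, real_inner_comm]

theorem exists_eigenbasis {ν : Measure ℝ} [IsFiniteMeasure ν] (hν : ν (Set.Icc 0 1)ᶜ = 0)
    (a : ℝ) (n : ℕ) :
    ∃ (e : OrthonormalBasis (Fin n) ℝ (EuclideanSpace ℝ (Fin n))) (γ : Fin n → ℝ),
      (∀ i j, ∫ x, featureSum a (e i) x * featureSum a (e j) x ∂ν = if i = j then γ i else 0) ∧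
      ∀ v, ∫ x, featureSum a v x ^ 2 ∂ν = ∑ i, γ i * inner ℝ (e i) v ^ 2 := by
  let A := Matrix.toEuclideanLin (featureGram ν a n)
  have hA : A.IsSymmetric := fun u v => by
    rw [inner_featureGram hν, real_inner_comm, inner_featureGram hν]
    simp_rw [mul_comm]
  have hn : Module.finrank ℝ (EuclideanSpace ℝ (Fin n)) = n := by simp
  refine ⟨hA.eigenvectorBasis hn, hA.eigenvalues hn, fun i j => ?_, fun v => ?_⟩
  · rw [← inner_featureGram hν]
    change inner ℝ (A _) _ = _
    rw [hA.apply_eigenvectorBasis, inner_smul_left, orthonormal_iff_ite.1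
      (hA.eigenvectorBasis hn).orthonormal]
    simp
  · have h1 : ∫ x, featureSum a v x ^ 2 ∂ν = inner ℝ (A v) v := by
      rw [inner_featureGram hν]; simp_rw [sq]
    rw [h1, ← (hA.eigenvectorBasis hn).sum_inner_mul_inner]
    refine Finset.sum_congr rfl fun i _ => ?_
    rw [hA, hA.apply_eigenvectorBasis, inner_smul_right, real_inner_comm]
    simp only [RCLike.ofReal_real_eq_id, id_eq]
    ring

theorem integral_gaussian_le_of_le_smul {ν : Measure ℝ} {M : ℝ} (hM : 0 ≤ M)
    (hνM : ν ≤ ENNReal.ofReal M • unitLebesgue) {a : ℝ} (ha : 0 < a) (y : ℝ) :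
    ∫ x, Real.exp (-(a ^ 2 * (x - y) ^ 2)) ∂ν ≤ M * √Real.pi / a := by
  have hi : Integrable (fun x : ℝ => Real.exp (-(a ^ 2 * (x - y) ^ 2))) := by
    have := (integrable_exp_neg_mul_sq (b := a ^ 2) (by positivity)).comp_sub_right y
    simpa [neg_mul] using this
  have h1 : ∫ x, Real.exp (-(a ^ 2 * (x - y) ^ 2)) ∂ν ≤
      ∫ x, Real.exp (-(a ^ 2 * (x - y) ^ 2)) ∂(ENNReal.ofReal M • (volume : Measure ℝ)) := by
    refine integral_mono_measure (hνM.trans ?_) (ae_of_all _ fun x => (Real.exp_pos _).le)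
      (hi.smul_measure ENNReal.ofReal_ne_top)
    gcongr
    exact Measure.restrict_le_self
  have h2 : ∫ x : ℝ, Real.exp (-(a ^ 2 * (x - y) ^ 2)) = √Real.pi / a := by
    rw [integral_sub_right_eq_self (fun x : ℝ => Real.exp (-(a ^ 2 * x ^ 2))) y]
    simp_rw [← neg_mul]
    rw [integral_gaussian, Real.sqrt_div' _ (by positivity), Real.sqrt_sq ha.le]
  rw [integral_smul_measure, ENNReal.toReal_ofReal hM, h2, smul_eq_mul] at h1
  rwa [mul_div_assoc]

/-- Schur's bound for the eigenvalues of the kernel operator. -/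
theorem eigenvalue_le {ν : Measure ℝ} [IsFiniteMeasure ν] (hν : ν (Set.Icc 0 1)ᶜ = 0) {M : ℝ}
    (hM : 0 ≤ M) (hνM : ν ≤ ENNReal.ofReal M • unitLebesgue) {a : ℝ} (ha : 0 < a) (n : ℕ)
    {f : ℝ → ℝ} (hf : Continuous f) {g : ℝ}
    (hfg : ∀ x, ∫ y, sqExpPartialKernel a n x y * f y ∂ν = g * f x)
    (hnorm : ∫ x, f x ^ 2 ∂ν = g) : g ≤ M * √Real.pi / a := by
  set B := M * √Real.pi / a
  have hB : 0 ≤ B := by positivity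
  have hfi : Integrable (fun x => |f x|) ν := integrable_of_continuous_of_Icc hν (by fun_prop)
  have hg : 0 ≤ g := hnorm ▸ integral_nonneg fun _ => sq_nonneg _
  have h0 : 0 ≤ ∫ x, |f x| ∂ν := integral_nonneg fun _ => abs_nonneg _
  rcases h0.eq_or_lt with h0 | h0
  · have h1 := (integral_eq_zero_iff_of_nonneg (fun _ => abs_nonneg _) hfi).1 h0.symm
    have h2 : ∫ x, f x ^ 2 ∂ν = 0 := by
      rw [← integral_zero ℝ ℝ (μ := ν)]
      refine integral_congr_ae ?_
      filter_upwards [h1] with x hx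
      have : f x = 0 := abs_eq_zero.1 hx
      simp [this]
    rw [← hnorm, h2]
    exact hB
  have hprod : Integrable (fun z : ℝ × ℝ => Real.exp (-(a ^ 2 * (z.1 - z.2) ^ 2)) * |f z.2|)
      (ν.prod ν) := by
    refine (hfi.comp_snd ν).bdd_mul (c := 1) (by fun_prop) (ae_of_all _ fun z => ?_)
    rw [Real.norm_eq_abs, abs_of_pos (Real.exp_pos _), Real.exp_le_one_iff]
    exact neg_nonpos.2 (by positivity)
  have hae : ∀ᵐ x ∂ν, x ∈ Set.Icc (0 : ℝ) 1 := hν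
  have h1 : g * ∫ x, |f x| ∂ν ≤ ∫ x, ∫ y, Real.exp (-(a ^ 2 * (x - y) ^ 2)) * |f y| ∂ν ∂ν := by
    rw [← integral_const_mul]
    refine integral_mono_ae (hfi.const_mul _) hprod.integral_prod_left ?_
    filter_upwards [hae] with x hx
    rw [← abs_of_nonneg hg, ← abs_mul, ← hfg]
    refine (abs_integral_le_integral_abs).trans ?_
    refine integral_mono_of_nonneg (ae_of_all _ fun _ => abs_nonneg _) ?_ ?_
    · exact integrable_of_continuous_of_Icc hν (by fun_prop)
    · filter_upwards [hae] with y hy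
      rw [abs_mul, abs_of_nonneg (sqExpPartialKernel_nonneg a n hx.1 hy.1)]
      exact mul_le_mul_of_nonneg_right (sqExpPartialKernel_le a n hx.1 hy.1) (abs_nonneg _)
  have h2 : ∫ x, ∫ y, Real.exp (-(a ^ 2 * (x - y) ^ 2)) * |f y| ∂ν ∂ν ≤ B * ∫ x, |f x| ∂ν := by
    rw [integral_integral_swap (f := fun x y => Real.exp (-(a ^ 2 * (x - y) ^ 2)) * |f y|) hprod,
      ← integral_const_mul]
    refine integral_mono hprod.integral_prod_right (hfi.const_mul _) fun y => ?_
    simp only [integral_mul_const]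
    exact mul_le_mul_of_nonneg_right (integral_gaussian_le_of_le_smul hM hνM ha y) (abs_nonneg _)
  exact le_of_mul_le_mul_right (h1.trans h2) h0

theorem hasSpectralSubspace_of_card_eigenvalues {ν : Measure ℝ} {a l : ℝ} {n : ℕ}
    (e : OrthonormalBasis (Fin n) ℝ (EuclideanSpace ℝ (Fin n))) {γ : Fin n → ℝ}
    (hγ : ∀ v, ∫ x, featureSum a v x ^ 2 ∂ν = ∑ i, γ i * inner ℝ (e i) v ^ 2) {k : ℕ}
    (hk : k ≤ (Finset.univ.filter fun i => l ≤ γ i).card) : HasSpectralSubspace ν a k l := by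
  let S := Finset.univ.filter fun i => l ≤ γ i
  refine ⟨n, Submodule.span ℝ (Set.range fun i : S => e i), ?_, fun v hv => ?_⟩
  · have hli : LinearIndependent ℝ fun i : S => e i :=
      (e.orthonormal.comp _ Subtype.val_injective).linearIndependent
    rw [finrank_span_eq_card hli]
    simpa using hk
  · have h1 : ∀ j, j ∉ S → inner ℝ (e j) v = 0 := by
      intro j hj
      induction hv using Submodule.span_induction with
      | mem x hx =>
        obtain ⟨i, rfl⟩ := hx
        exact e.orthonormal.inner_eq_zero fun h => hj (h ▸ i.2)
      | zero => simp
      | add x y _ _ hx hy => rw [inner_add_right, hx, hy, add_zero]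
      | smul t x _ hx => rw [inner_smul_right, hx, mul_zero]
    rw [hγ, ← e.sum_sq_norm_inner_right, Finset.mul_sum]
    refine Finset.sum_le_sum fun i _ => ?_
    rw [Real.norm_eq_abs, sq_abs]
    by_cases hi : i ∈ S
    · exact mul_le_mul_of_nonneg_right (Finset.mem_filter.1 hi).2 (sq_nonneg _)
    · simp [h1 i hi]

/-- A second-moment count. With eigenvalues `γ i`, one has `∑ γ i ≤ 1`, `∑ (γ i)² ≥ 1.02 / a` and `γ
i ≤ M √π / a`. Eigenvalues below `1 / a` contribute at most `1 / a` to the sum of squares, so those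
above supply `0.02 / a`, each at most `M² π / a²`. -/
theorem hasSpectralSubspace_of_bounded_density {ν : Measure ℝ} [IsFiniteMeasure ν]
    (hν : ν (Set.Icc 0 1)ᶜ = 0) {M : ℝ} (hM : 0 < M)
    (hνM : ν ≤ ENNReal.ofReal M • unitLebesgue) (hθ : 0.99 ≤ ν.real Set.univ)
    (hθ' : ν.real Set.univ ≤ 1) {a : ℝ} (ha : 100 ≤ a) {k : ℕ}
    (hk : k ≤ 0.02 / (M ^ 2 * Real.pi) * a) : HasSpectralSubspace ν a k (1 / a) := by
  have ha0 : 0 < a := by linarith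
  obtain ⟨n, hn⟩ := (eventually_exp_sub_le_sqExpPartialKernel a
    (δ := 0.005 / a) (by positivity)).exists
  obtain ⟨e, γ, horth, hγ⟩ := exists_eigenbasis hν a n
  set F : Fin n → ℝ → ℝ := fun i => featureSum a (e i) with hF
  have hFc : ∀ i, Continuous (F i) := fun i => by fun_prop
  have hFi : ∀ i j, Integrable (fun x => F i x * F j x) ν := fun i j =>
    integrable_of_continuous_of_Icc hν ((hFc i).mul (hFc j))
  have hKF : ∀ x y, sqExpPartialKernel a n x y = ∑ i, F i x * F i y :=
    sqExpPartialKernel_eq_sum_featureSum a e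
  have hγF : ∀ i, ∫ x, F i x ^ 2 ∂ν = γ i := fun i => by
    have := horth i i
    simpa [sq] using this
  have hγ0 : ∀ i, 0 ≤ γ i := fun i => hγF i ▸ integral_nonneg fun _ => sq_nonneg _
  have hae : ∀ᵐ x ∂ν, x ∈ Set.Icc (0 : ℝ) 1 := hν
  have hsum : ∑ i, γ i ≤ 1 := by
    have h1 : ∑ i, γ i = ∫ x, sqExpPartialKernel a n x x ∂ν := by
      simp_rw [hKF]
      rw [integral_finsetSum _ fun i _ => hFi i i]
      exact Finset.sum_congr rfl fun i _ => by rw [← hγF]; simp_rw [sq]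
    have h2 : ∫ x, sqExpPartialKernel a n x x ∂ν ≤ ∫ _x, (1 : ℝ) ∂ν := by
      refine integral_mono_ae ?_ (integrable_const _) ?_
      · simp_rw [hKF]
        exact integrable_finsetSum _ fun i _ => hFi i i
      · filter_upwards [hae] with x hx
        refine (sqExpPartialKernel_le a n hx.1 hx.1).trans ?_
        simp
    rw [h1]
    refine h2.trans ?_
    simpa using hθ'
  have hprodF : ∀ i j, Integrable (fun z : ℝ × ℝ => (F i z.1 * F j z.1) * (F i z.2 * F j z.2))
      (ν.prod ν) := fun i j => (hFi i j).mul_prod (hFi i j)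
  have hKsq : ∀ z : ℝ × ℝ, sqExpPartialKernel a n z.1 z.2 ^ 2 =
      ∑ i, ∑ j, (F i z.1 * F j z.1) * (F i z.2 * F j z.2) := fun z => by
    rw [hKF, sq, Finset.sum_mul_sum]
    exact Finset.sum_congr rfl fun i _ => Finset.sum_congr rfl fun j _ => by ring
  have hKsqi : Integrable (fun z : ℝ × ℝ => sqExpPartialKernel a n z.1 z.2 ^ 2) (ν.prod ν) := by
    simp_rw [hKsq]
    exact integrable_finsetSum _ fun i _ => integrable_finsetSum _ fun j _ => hprodF i j
  have hsumsq : ∑ i, γ i ^ 2 = ∫ z : ℝ × ℝ, sqExpPartialKernel a n z.1 z.2 ^ 2 ∂(ν.prod ν) := by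
    simp_rw [hKsq]
    rw [integral_finsetSum _ fun i _ => integrable_finsetSum _ fun j _ => hprodF i j]
    refine Finset.sum_congr rfl fun i _ => ?_
    rw [integral_finsetSum _ fun j _ => hprodF i j]
    have h1 : ∀ j, ∫ z : ℝ × ℝ, (F i z.1 * F j z.1) * (F i z.2 * F j z.2) ∂(ν.prod ν) =
        if i = j then γ i ^ 2 else 0 := fun j => by
      rw [integral_prod_mul (fun x => F i x * F j x) (fun x => F i x * F j x), horth]
      split_ifs
      · rw [sq]
      · simp
    simp_rw [h1]
    simp
  -- The squared kernel is the Gaussian kernel with parameter `√2 a`, whose energy is about `1.51 /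
  -- (√2 a)`. Since `1.51 > √2`, a margin over `1 / a` survives the missing mass, the term `1.51` in
  -- the denominator (here `a ≥ 100` enters) and the truncation of the kernel.
  have hlow : 1.02 / a ≤ ∑ i, γ i ^ 2 := by
    have h1 := gaussian_energy_lower_bound hν (b := √2 * a) (by positivity)
    have hi := integrable_gaussian_prod ν ν (√2 * a)
    have h2 : ∫ z : ℝ × ℝ, Real.exp (-((√2 * a) ^ 2 * (z.1 - z.2) ^ 2)) ∂(ν.prod ν) -
        ∑ i, γ i ^ 2 ≤ 0.01 / a := by
      rw [hsumsq, ← integral_sub hi hKsqi]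
      have h3 : ∫ _z : ℝ × ℝ, 0.01 / a ∂(ν.prod ν) ≤ 0.01 / a := by
        rw [integral_const, measureReal_def, ← Set.univ_prod_univ, Measure.prod_prod,
          ENNReal.toReal_mul, ← measureReal_def, smul_eq_mul]
        exact mul_le_of_le_one_left (by positivity) (mul_le_one₀ hθ' measureReal_nonneg hθ')
      refine le_trans (integral_mono_ae (hi.sub hKsqi) (integrable_const _) ?_) h3
      filter_upwards [ae_prod_mem_Icc hν] with z hz
      have h4 := hn z.1 hz.1 z.2 hz.2
      have h5 := sqExpPartialKernel_le a n hz.1.1 hz.2.1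
      have h6 := sqExpPartialKernel_nonneg a n hz.1.1 hz.2.1
      have h7 : Real.exp (-((√2 * a) ^ 2 * (z.1 - z.2) ^ 2)) =
          Real.exp (-(a ^ 2 * (z.1 - z.2) ^ 2)) ^ 2 := by
        rw [← Real.exp_nat_mul, mul_pow, Real.sq_sqrt (by norm_num)]
        congr 1; push_cast; ring
      have h8 : Real.exp (-(a ^ 2 * (z.1 - z.2) ^ 2)) ≤ 1 := by
        rw [Real.exp_le_one_iff]; exact neg_nonpos.2 (by positivity)
      rw [h7, sq_sub_sq]
      have h9 : 0.01 / a = 2 * (0.005 / a) := by ring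
      rw [h9]
      exact mul_le_mul (by linarith) (by linarith) (by linarith) (by norm_num)
    have h10 : 1.03 / a ≤ ν.real Set.univ ^ 2 * (1.51 / (√2 * a + 1.51)) := by
      have h11 : √2 ≤ 1.4143 := by rw [Real.sqrt_le_left (by norm_num)]; norm_num
      have h12 : (0.98 : ℝ) ≤ ν.real Set.univ ^ 2 := by nlinarith
      have h13 : 1.055 / a ≤ 1.51 / (√2 * a + 1.51) := by
        rw [div_le_div_iff₀ ha0 (by positivity)]
        nlinarith
      refine le_trans ?_ (mul_le_mul h12 h13 (by positivity) (sq_nonneg _))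
      rw [← mul_div_assoc]
      gcongr
      norm_num
    have h14 : 1.02 / a + 0.01 / a = 1.03 / a := by ring
    linarith
  refine hasSpectralSubspace_of_card_eigenvalues e hγ ?_
  set S := Finset.univ.filter fun i => 1 / a ≤ γ i
  have hup : ∀ i, γ i ≤ M * √Real.pi / a := fun i => by
    refine eigenvalue_le hν hM.le hνM ha0 n (hFc i) (fun x => ?_) (hγF i)
    simp_rw [hKF, Finset.sum_mul, mul_assoc]
    rw [integral_finsetSum _ fun j _ => (hFi j i).const_mul _]
    simp_rw [integral_const_mul]
    have h1 : ∀ j, ∫ y, F j y * F i y ∂ν = if j = i then γ j else 0 := fun j => horth j i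
    simp_rw [h1]
    simp [mul_comm]
  have hcount : ∑ i, γ i ^ 2 ≤ S.card * (M ^ 2 * Real.pi / a ^ 2) + 1 / a := by
    have h1 : ∀ i, γ i ^ 2 ≤ (if 1 / a ≤ γ i then M ^ 2 * Real.pi / a ^ 2 else 0) + γ i * (1 / a) := by
      intro i
      split_ifs with h
      · have h2 := pow_le_pow_left₀ (hγ0 i) (hup i) 2
        rw [div_pow, mul_pow, Real.sq_sqrt Real.pi_pos.le] at h2
        have h3 : 0 ≤ γ i * (1 / a) := mul_nonneg (hγ0 i) (by positivity)
        linarith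
      · rw [zero_add, sq]
        exact mul_le_mul_of_nonneg_left (not_le.1 h).le (hγ0 i)
    refine (Finset.sum_le_sum fun i _ => h1 i).trans ?_
    rw [Finset.sum_add_distrib, ← Finset.sum_mul, ← Finset.sum_filter, Finset.sum_const,
      nsmul_eq_mul]
    have h4 : (∑ i, γ i) * (1 / a) ≤ 1 * (1 / a) :=
      mul_le_mul_of_nonneg_right hsum (by positivity)
    linarith
  have hfin : 0.02 / a ≤ S.card * (M ^ 2 * Real.pi / a ^ 2) := by
    have : 1.02 / a = 0.02 / a + 1 / a := by ring
    linarith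
  have hfin2 : 0.02 / (M ^ 2 * Real.pi) * a ≤ S.card := by
    have hpi := Real.pi_pos
    rw [← mul_div_assoc, div_le_div_iff₀ ha0 (by positivity)] at hfin
    rw [div_mul_eq_mul_div, div_le_iff₀ (by positivity)]
    have h1 : 0.02 * a * a ≤ (S.card * (M ^ 2 * Real.pi)) * a := by nlinarith
    exact le_of_mul_le_mul_right h1 ha0
  exact_mod_cast hk.trans hfin2

/-- The density may be unbounded, whereas Schur's bound needs a bounded one. Cutting it at a high
level loses at most one percent of the mass; the level `M` makes the final constant depend on `μ`.
-/
theorem IsDesignDensity.exists_truncation {c₀ : ℝ} {μ : I → ℝ} (hμ : IsDesignDensity c₀ μ) :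
    ∃ (M : ℝ) (ν : Measure ℝ), 0 < M ∧ ν ≤ realLaw μ ∧ ν ≤ ENNReal.ofReal M • unitLebesgue ∧
      0.99 ≤ ν.real Set.univ := by
  let u : ℕ → I → ℝ≥0∞ := fun m x => min (ENNReal.ofReal (μ x)) (m : ℝ≥0∞)
  have hmeas : ∀ m, Measurable (u m) := fun m => by
    have := hμ.measurable
    fun_prop
  have hmono : Monotone u := fun m m' h x => min_le_min_left _ (by exact_mod_cast h)
  have hsup : ∀ x, ⨆ m, u m x = ENNReal.ofReal (μ x) := fun x => by
    obtain ⟨m, hm⟩ := exists_nat_ge (μ x)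
    refine le_antisymm (iSup_le fun m => min_le_left _ _) (le_iSup_of_le m (le_min le_rfl ?_))
    rw [← ENNReal.ofReal_natCast]
    exact ENNReal.ofReal_le_ofReal hm
  have hlim : ⨆ m, ∫⁻ x, u m x = 1 := by
    rw [← lintegral_iSup hmeas hmono]
    simp_rw [hsup]
    exact hμ.lintegral_eq_one
  have h1 : ENNReal.ofReal 0.99 < ⨆ m, ∫⁻ x, u m x := by
    rw [hlim, ENNReal.ofReal_lt_one]; norm_num
  obtain ⟨m, hm⟩ := lt_iSup_iff.1 h1
  have hM : ENNReal.ofReal ((m : ℝ) + 1) = m + 1 := by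
    rw [ENNReal.ofReal_add (by positivity) zero_le_one]; simp
  refine ⟨m + 1, ((volume : Measure I).withDensity (u m)).map (fun x : I => (x : ℝ)),
    by positivity, ?_, ?_, ?_⟩
  · refine Measure.map_mono (withDensity_mono (ae_of_all _ fun x => min_le_left _ _)) (by fun_prop)
  · rw [← map_coe_volume_unitInterval, ← Measure.map_smul, ← withDensity_const]
    refine Measure.map_mono (withDensity_mono (ae_of_all _ fun x => ?_)) (by fun_prop)
    rw [hM]
    exact (min_le_right _ _).trans le_self_add
  · rw [measureReal_def, Measure.map_apply (by fun_prop) MeasurableSet.univ, Set.preimage_univ,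
      withDensity_apply _ MeasurableSet.univ, Measure.restrict_univ]
    have hne : ∫⁻ x, u m x ≠ ∞ := by
      refine ne_top_of_le_ne_top ENNReal.one_ne_top ?_
      rw [← hlim]
      exact le_iSup (fun m => ∫⁻ x, u m x) m
    rw [← ENNReal.ofReal_le_iff_le_toReal hne]
    exact hm.le

/-- The kernel operator of a design density has at least a constant multiple of `a` eigenvalues
above `1 / a`, for large `a`. -/
theorem IsDesignDensity.exists_spectralSubspace_linear {c₀ : ℝ} {μ : I → ℝ}
    (hμ : IsDesignDensity c₀ μ) : ∃ c : ℝ, 0 < c ∧ ∀ (a : ℝ) (k : ℕ), 100 ≤ a → k ≤ c * a →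
      HasSpectralSubspace (realLaw μ) a k (1 / a) := by
  obtain ⟨M, ν, hM, hle, hνM, hθ⟩ := hμ.exists_truncation
  have := hμ.isProbabilityMeasure_realLaw
  have : IsFiniteMeasure ν := isFiniteMeasure_of_le _ hle
  have hθ' : ν.real Set.univ ≤ 1 := by
    rw [← probReal_univ (μ := realLaw μ)]
    exact ENNReal.toReal_mono (measure_ne_top _ _) (hle _)
  refine ⟨0.02 / (M ^ 2 * Real.pi), by positivity, fun a k ha hk => ?_⟩
  refine HasSpectralSubspace.mono_measure ?_ hle (realLaw_compl_Icc μ)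
  exact hasSpectralSubspace_of_bounded_density (le_antisymm ((hle _).trans_eq (realLaw_compl_Icc μ))
    zero_le) hM hνM hθ hθ' ha hk

/-! ### Comparison of Gaussian energies -/

/-- The energy of a density for the Gaussian kernel. -/
noncomputable def gaussianEnergy (ν : Measure ℝ) (h : ℝ → ℝ) (b : ℝ) : ℝ :=
  ∫ z : ℝ × ℝ, Real.exp (-(b ^ 2 * (z.1 - z.2) ^ 2)) * (h z.1 * h z.2) ∂(ν.prod ν)

theorem integral_exp_mul_cos {b : ℝ} (hb : 0 < b) (r : ℝ) :
    ∫ t : ℝ, Real.exp (-(t ^ 2 / (4 * b ^ 2))) * Real.cos (t * r) =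
      2 * √Real.pi * (b * Real.exp (-(b ^ 2 * r ^ 2))) := by
  have hs : 0 < ((1 / (4 * b ^ 2) : ℝ) : ℂ).re := by
    rw [Complex.ofReal_re]; positivity
  have h := fourierIntegral_gaussian hs (r : ℂ)
  have h1 : ∀ t : ℝ, Complex.exp (Complex.I * r * t) *
      Complex.exp (-((1 / (4 * b ^ 2) : ℝ) : ℂ) * t ^ 2) =
      ((Real.exp (-(t ^ 2 / (4 * b ^ 2))) : ℝ) : ℂ) * Complex.exp ((t * r : ℝ) * Complex.I) := by
    intro t
    rw [mul_comm, Complex.ofReal_exp]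
    congr 2
    · push_cast; ring
    · push_cast; ring
  simp_rw [h1] at h
  have h2 : Integrable (fun t : ℝ => ((Real.exp (-(t ^ 2 / (4 * b ^ 2))) : ℝ) : ℂ) *
      Complex.exp ((t * r : ℝ) * Complex.I)) := by
    -- Integrability follows from the known nonzero value, since an undefined integral would be `0`.
    by_contra hne
    rw [integral_undef hne] at h
    have h3 : ((Real.pi : ℂ) / ((1 / (4 * b ^ 2) : ℝ) : ℂ)) ≠ 0 := by
      refine div_ne_zero (by exact_mod_cast Real.pi_ne_zero) ?_
      exact_mod_cast (by positivity : (1 / (4 * b ^ 2) : ℝ) ≠ 0)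
    refine (mul_ne_zero ?_ (Complex.exp_ne_zero _)) h.symm
    rw [Complex.cpow_def_of_ne_zero h3]
    exact Complex.exp_ne_zero _
  have h4 := congrArg Complex.re h
  have h5 := integral_re h2
  simp only [RCLike.re_to_complex] at h5
  rw [← h5] at h4
  simp only [Complex.re_ofReal_mul, Complex.exp_ofReal_mul_I_re] at h4
  rw [h4]
  have h6 : ((Real.pi : ℂ) / ((1 / (4 * b ^ 2) : ℝ) : ℂ)) ^ (1 / 2 : ℂ) =
      ((2 * √Real.pi * b : ℝ) : ℂ) := by
    have h7 : (2 * √Real.pi * b : ℝ) = (Real.pi / (1 / (4 * b ^ 2))) ^ (1 / 2 : ℝ) := by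
      rw [← Real.sqrt_eq_rpow, div_div_eq_mul_div, div_one,
        show Real.pi * (4 * b ^ 2) = Real.pi * (2 * b) ^ 2 by ring,
        Real.sqrt_mul Real.pi_pos.le, Real.sqrt_sq (by positivity)]
      ring
    rw [h7, Complex.ofReal_cpow (by positivity)]
    push_cast
    rfl
  have h8 : Complex.exp (-(r : ℂ) ^ 2 / (4 * ((1 / (4 * b ^ 2) : ℝ) : ℂ))) =
      ((Real.exp (-(b ^ 2 * r ^ 2)) : ℝ) : ℂ) := by
    rw [Complex.ofReal_exp]
    congr 1
    have hbc : (b : ℂ) ≠ 0 := by exact_mod_cast hb.ne'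
    push_cast
    field_simp
  rw [h6, h8, ← Complex.ofReal_mul, Complex.ofReal_re]
  ring

/-- With `w = t²` the squared frequency and `R` a cutoff: for `w ≤ R` drop the subtracted term, and
for `w > R` the left side is nonpositive. -/
theorem exp_comparison {s₀ s₁ s₂ R w : ℝ} (h01 : s₀ ≤ s₁) (h2 : 0 ≤ s₂) (h1 : 0 ≤ s₁) (hw : 0 ≤ w) :
    Real.exp (-(s₂ * R)) *
      (Real.exp (-(s₁ * w)) - Real.exp (-((s₁ - s₀) * R)) * Real.exp (-(s₀ * w))) ≤
      Real.exp (-(s₂ * w)) := by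
  rcases le_or_gt w R with h | h
  · have h3 : Real.exp (-(s₁ * w)) ≤ 1 := by
      rw [Real.exp_le_one_iff]; exact neg_nonpos.2 (by positivity)
    have h4 : Real.exp (-(s₂ * R)) ≤ Real.exp (-(s₂ * w)) := by
      rw [Real.exp_le_exp]; nlinarith
    have h5 : 0 ≤ Real.exp (-((s₁ - s₀) * R)) * Real.exp (-(s₀ * w)) := by positivity
    have h6 := Real.exp_pos (-(s₂ * R))
    nlinarith
  · refine le_trans (mul_nonpos_of_nonneg_of_nonpos (Real.exp_pos _).le ?_) (Real.exp_pos _).le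
    rw [sub_nonpos, ← Real.exp_add, Real.exp_le_exp]
    nlinarith

theorem integrable_exp_mul_cos_prod {ν : Measure ℝ} [IsFiniteMeasure ν] {h : ℝ → ℝ}
    (hh : Measurable h) {M : ℝ} (hM : ∀ x, |h x| ≤ M)
    {b : ℝ} (hb : 0 < b) :
    Integrable (fun p : ℝ × (ℝ × ℝ) => Real.exp (-(p.1 ^ 2 / (4 * b ^ 2))) *
      Real.cos (p.1 * (p.2.1 - p.2.2)) * (h p.2.1 * h p.2.2)) (volume.prod (ν.prod ν)) := by
  have h1 : Integrable (fun t : ℝ => Real.exp (-(t ^ 2 / (4 * b ^ 2)))) := by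
    have := integrable_exp_neg_mul_sq (b := 1 / (4 * b ^ 2)) (by positivity)
    refine this.congr (ae_of_all _ fun t => ?_)
    beta_reduce
    congr 1; ring
  have hM0 : 0 ≤ M := (abs_nonneg _).trans (hM 0)
  have h2 := (h1.comp_fst (ν.prod ν)).mul_bdd (c := M * M)
    (g := fun p : ℝ × (ℝ × ℝ) => Real.cos (p.1 * (p.2.1 - p.2.2)) * (h p.2.1 * h p.2.2))
    (by fun_prop) (ae_of_all _ fun p => ?_)
  · refine h2.congr (ae_of_all _ fun p => ?_)
    beta_reduce
    ring
  · rw [norm_mul, norm_mul]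
    refine (mul_le_of_le_one_left (by positivity) (Real.abs_cos_le_one _)).trans ?_
    exact mul_le_mul (hM _) (hM _) (abs_nonneg _) hM0

theorem integral_cos_mul_nonneg {ν : Measure ℝ} [IsFiniteMeasure ν] {h : ℝ → ℝ}
    (hh : Measurable h) {M : ℝ} (hM : ∀ x, |h x| ≤ M)
    (t : ℝ) :
    0 ≤ ∫ z : ℝ × ℝ, Real.cos (t * (z.1 - z.2)) * (h z.1 * h z.2) ∂(ν.prod ν) := by
  have hc : Integrable (fun x => Real.cos (t * x) * h x) ν := by
    refine Integrable.of_bound (by fun_prop) M (ae_of_all _ fun x => ?_)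
    rw [norm_mul]
    exact (mul_le_of_le_one_left (norm_nonneg _) (Real.abs_cos_le_one _)).trans (hM x)
  have hs : Integrable (fun x => Real.sin (t * x) * h x) ν := by
    refine Integrable.of_bound (by fun_prop) M (ae_of_all _ fun x => ?_)
    rw [norm_mul]
    exact (mul_le_of_le_one_left (norm_nonneg _) (Real.abs_sin_le_one _)).trans (hM x)
  have h1 : ∫ z : ℝ × ℝ, Real.cos (t * (z.1 - z.2)) * (h z.1 * h z.2) ∂(ν.prod ν) =
      (∫ x, Real.cos (t * x) * h x ∂ν) ^ 2 + (∫ x, Real.sin (t * x) * h x ∂ν) ^ 2 := by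
    rw [sq, sq, ← integral_prod_mul (fun x => Real.cos (t * x) * h x) (fun x => Real.cos (t * x) * h x),
      ← integral_prod_mul (fun x => Real.sin (t * x) * h x) (fun x => Real.sin (t * x) * h x),
      ← integral_add (hc.mul_prod hc) (hs.mul_prod hs)]
    refine integral_congr_ae (ae_of_all _ fun z => ?_)
    beta_reduce
    rw [mul_sub, Real.cos_sub]
    ring
  rw [h1]
  positivity

/-- On the Fourier side `b` times the energy is an integral of `exp (-t² / (4 b²))` against a
nonnegative density that does not depend on `b`. Energies with different `b` can therefore be
compared frequency by frequency. -/
theorem integral_fourier_eq_gaussianEnergy {ν : Measure ℝ} [IsFiniteMeasure ν] {h : ℝ → ℝ}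
    (hh : Measurable h) {M : ℝ} (hM : ∀ x, |h x| ≤ M)
    {b : ℝ} (hb : 0 < b) :
    ∫ t : ℝ, Real.exp (-(t ^ 2 / (4 * b ^ 2))) *
        ∫ z : ℝ × ℝ, Real.cos (t * (z.1 - z.2)) * (h z.1 * h z.2) ∂(ν.prod ν) =
      2 * √Real.pi * (b * gaussianEnergy ν h b) := by
  have h1 := integral_integral_swap
    (f := fun (t : ℝ) (z : ℝ × ℝ) => Real.exp (-(t ^ 2 / (4 * b ^ 2))) *
      Real.cos (t * (z.1 - z.2)) * (h z.1 * h z.2)) (integrable_exp_mul_cos_prod (ν := ν) hh hM hb)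
  simp only [mul_assoc, integral_const_mul] at h1
  rw [h1, gaussianEnergy, ← integral_const_mul, ← integral_const_mul]
  refine integral_congr_ae (ae_of_all _ fun z => ?_)
  beta_reduce
  simp_rw [← mul_assoc]
  rw [integral_mul_const, integral_mul_const, integral_exp_mul_cos hb]
  ring

theorem integrable_fourier {ν : Measure ℝ} [IsFiniteMeasure ν] {h : ℝ → ℝ}
    (hh : Measurable h) {M : ℝ} (hM : ∀ x, |h x| ≤ M)
    {b : ℝ} (hb : 0 < b) :
    Integrable (fun t : ℝ => Real.exp (-(t ^ 2 / (4 * b ^ 2))) *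
        ∫ z : ℝ × ℝ, Real.cos (t * (z.1 - z.2)) * (h z.1 * h z.2) ∂(ν.prod ν)) := by
  have h1 := (integrable_exp_mul_cos_prod (ν := ν) hh hM hb).integral_prod_left
  simpa only [mul_assoc, integral_const_mul] using h1

/-- A lower bound for the energy of a wide Gaussian kernel in terms of narrower ones. -/
theorem gaussianEnergy_comparison {ν : Measure ℝ} [IsFiniteMeasure ν] {h : ℝ → ℝ}
    (hh : Measurable h) {M : ℝ} (hM : ∀ x, |h x| ≤ M)
    {a b b' : ℝ} (ha : 0 < a) (hb : 0 < b) (hbb : b ≤ b') (R : ℝ) :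
    Real.exp (-(1 / (4 * a ^ 2) * R)) * (b * gaussianEnergy ν h b -
      Real.exp (-((1 / (4 * b ^ 2) - 1 / (4 * b' ^ 2)) * R)) * (b' * gaussianEnergy ν h b')) ≤
      a * gaussianEnergy ν h a := by
  have hb' : 0 < b' := hb.trans_le hbb
  set P : ℝ → ℝ := fun t => ∫ z : ℝ × ℝ, Real.cos (t * (z.1 - z.2)) * (h z.1 * h z.2) ∂(ν.prod ν)
  set A := Real.exp (-(1 / (4 * a ^ 2) * R))
  set D := Real.exp (-((1 / (4 * b ^ 2) - 1 / (4 * b' ^ 2)) * R))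
  have hia := integrable_fourier (ν := ν) hh hM ha
  have hib := integrable_fourier (ν := ν) hh hM hb
  have hib' := integrable_fourier (ν := ν) hh hM hb'
  have h1 : ∫ t : ℝ, A * (Real.exp (-(t ^ 2 / (4 * b ^ 2))) * P t -
      D * (Real.exp (-(t ^ 2 / (4 * b' ^ 2))) * P t)) ≤
      ∫ t : ℝ, Real.exp (-(t ^ 2 / (4 * a ^ 2))) * P t := by
    refine integral_mono ((hib.sub (hib'.const_mul D)).const_mul A) hia fun t => ?_
    have h2 := exp_comparison (s₀ := 1 / (4 * b' ^ 2)) (s₁ := 1 / (4 * b ^ 2))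
      (s₂ := 1 / (4 * a ^ 2)) (R := R) (w := t ^ 2) (by gcongr) (by positivity) (by positivity)
      (sq_nonneg t)
    have h3 : 0 ≤ P t := integral_cos_mul_nonneg hh hM t
    have h4 := mul_le_mul_of_nonneg_right h2 h3
    simp only [one_div_mul_eq_div] at h4
    refine le_trans (le_of_eq ?_) h4
    simp only [A, D, one_div_mul_eq_div]
    ring
  rw [integral_const_mul, integral_sub hib (hib'.const_mul D), integral_const_mul,
    integral_fourier_eq_gaussianEnergy hh hM ha, integral_fourier_eq_gaussianEnergy hh hM hb,
    integral_fourier_eq_gaussianEnergy hh hM hb'] at h1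
  have hpi : 0 < 2 * √Real.pi := by have := Real.pi_pos; positivity
  refine le_of_mul_le_mul_left ?_ hpi
  refine le_trans (le_of_eq ?_) h1
  ring

theorem integral_gaussian_mul_sq_le {ν : Measure ℝ} [IsFiniteMeasure ν] {h : ℝ → ℝ}
    (hh : Measurable h) {M : ℝ} (hM : ∀ x, |h x| ≤ M)
    (hν : ν ≤ unitLebesgue) {b : ℝ} (hb : 0 < b) :
    ∫ z : ℝ × ℝ, Real.exp (-(b ^ 2 * (z.1 - z.2) ^ 2)) * ((h z.1 ^ 2 + h z.2 ^ 2) / 2) ∂(ν.prod ν) ≤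
      √Real.pi / b * ∫ x, h x ^ 2 ∂ν := by
  have hsq := integrable_sq_of_bounded (ν := ν) hh hM
  have hbd : ∀ᵐ z ∂(ν.prod ν), ‖Real.exp (-(b ^ 2 * (z.1 - z.2) ^ 2))‖ ≤ 1 := by
    refine ae_of_all _ fun z => ?_
    rw [Real.norm_eq_abs, abs_of_pos (Real.exp_pos _), Real.exp_le_one_iff]
    exact neg_nonpos.2 (by positivity)
  have hi1 : Integrable (fun z : ℝ × ℝ => Real.exp (-(b ^ 2 * (z.1 - z.2) ^ 2)) * h z.1 ^ 2)
      (ν.prod ν) := (hsq.comp_fst ν).bdd_mul (c := 1) (by fun_prop) hbd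
  have hi2 : Integrable (fun z : ℝ × ℝ => Real.exp (-(b ^ 2 * (z.1 - z.2) ^ 2)) * h z.2 ^ 2)
      (ν.prod ν) := (hsq.comp_snd ν).bdd_mul (c := 1) (by fun_prop) hbd
  have hν1 : ν ≤ ENNReal.ofReal 1 • unitLebesgue := by simpa using hν
  have key : ∀ y, ∫ x, Real.exp (-(b ^ 2 * (x - y) ^ 2)) ∂ν ≤ √Real.pi / b := fun y => by
    simpa using integral_gaussian_le_of_le_smul zero_le_one hν1 hb y
  have h2 : ∫ z : ℝ × ℝ, Real.exp (-(b ^ 2 * (z.1 - z.2) ^ 2)) * h z.2 ^ 2 ∂(ν.prod ν) ≤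
      √Real.pi / b * ∫ x, h x ^ 2 ∂ν := by
    rw [integral_prod_symm _ hi2, ← integral_const_mul]
    refine integral_mono hi2.integral_prod_right (hsq.const_mul _) fun y => ?_
    simp only [integral_mul_const]
    exact mul_le_mul_of_nonneg_right (key y) (sq_nonneg _)
  have h1 : ∫ z : ℝ × ℝ, Real.exp (-(b ^ 2 * (z.1 - z.2) ^ 2)) * h z.1 ^ 2 ∂(ν.prod ν) ≤
      √Real.pi / b * ∫ x, h x ^ 2 ∂ν := by
    rw [integral_prod _ hi1, ← integral_const_mul]
    refine integral_mono hi1.integral_prod_left (hsq.const_mul _) fun y => ?_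
    simp only [integral_mul_const]
    refine mul_le_mul_of_nonneg_right (le_trans (le_of_eq ?_) (key y)) (sq_nonneg _)
    exact integral_congr_ae (ae_of_all _ fun x => by beta_reduce; congr 1; ring)
  have h3 : ∫ z : ℝ × ℝ, Real.exp (-(b ^ 2 * (z.1 - z.2) ^ 2)) * ((h z.1 ^ 2 + h z.2 ^ 2) / 2)
      ∂(ν.prod ν) = ((∫ z : ℝ × ℝ, Real.exp (-(b ^ 2 * (z.1 - z.2) ^ 2)) * h z.1 ^ 2 ∂(ν.prod ν)) +
        ∫ z : ℝ × ℝ, Real.exp (-(b ^ 2 * (z.1 - z.2) ^ 2)) * h z.2 ^ 2 ∂(ν.prod ν)) / 2 := by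
    rw [← integral_add hi1 hi2, ← integral_div]
    exact integral_congr_ae (ae_of_all _ fun x => by beta_reduce; ring)
  rw [h3]
  linarith

theorem integrable_gaussian_mul_sq {ν : Measure ℝ} [IsFiniteMeasure ν] {h : ℝ → ℝ}
    (hh : Measurable h) {M : ℝ} (hM : ∀ x, |h x| ≤ M)
    (b : ℝ) :
    Integrable (fun z : ℝ × ℝ => Real.exp (-(b ^ 2 * (z.1 - z.2) ^ 2)) *
      ((h z.1 ^ 2 + h z.2 ^ 2) / 2)) (ν.prod ν) := by
  have hsq := integrable_sq_of_bounded (ν := ν) hh hM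
  refine (((hsq.comp_fst ν).add (hsq.comp_snd ν)).div_const 2).bdd_mul (c := 1) (by fun_prop)
    (ae_of_all _ fun z => ?_)
  rw [Real.norm_eq_abs, abs_of_pos (Real.exp_pos _), Real.exp_le_one_iff]
  exact neg_nonpos.2 (by positivity)

theorem gaussianEnergy_le {ν : Measure ℝ} [IsFiniteMeasure ν] {h : ℝ → ℝ}
    (hh : Measurable h) {M : ℝ} (hM : ∀ x, |h x| ≤ M)
    (hν : ν ≤ unitLebesgue) {b : ℝ} (hb : 0 < b) :
    b * gaussianEnergy ν h b ≤ √Real.pi * ∫ x, h x ^ 2 ∂ν := by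
  have h1 : gaussianEnergy ν h b ≤ √Real.pi / b * ∫ x, h x ^ 2 ∂ν := by
    refine le_trans ?_ (integral_gaussian_mul_sq_le hh hM hν hb)
    refine integral_mono (integrable_bounded_mul_prod hh hM (by fun_prop) (B := 1) fun z => ?_)
      (integrable_gaussian_mul_sq hh hM b) fun z => ?_
    · rw [abs_of_pos (Real.exp_pos _), Real.exp_le_one_iff]
      exact neg_nonpos.2 (by positivity)
    · refine mul_le_mul_of_nonneg_left ?_ (Real.exp_pos _).le
      nlinarith [sq_nonneg (h z.1 - h z.2)]
  have h2 := mul_le_mul_of_nonneg_left h1 hb.le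
  refine h2.trans (le_of_eq ?_)
  field_simp

/-! ### Step functions -/

/-- The first quarter of the `i`-th cell of the partition of the line into cells of length `1 / k`. -/
def quarterCell (k i : ℕ) : Set ℝ := Set.Ico ((i : ℝ) / k) ((i + 1 / 4) / k)

/-- The step functions on the quarter cells in the unit interval. -/
noncomputable def quarterStep (k : ℕ) : (Fin k → ℝ) →ₗ[ℝ] (ℝ → ℝ) :=
  ∑ i : Fin k, (LinearMap.toSpanSingleton ℝ (ℝ → ℝ) ((quarterCell k i).indicator 1)) ∘ₗ LinearMap.proj i

theorem quarterStep_apply {k : ℕ} (c : Fin k → ℝ) (x : ℝ) :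
    quarterStep k c x = ∑ i, c i * (quarterCell k i).indicator 1 x := by
  simp [quarterStep]

theorem abs_sub_of_mem_quarterCell {k i j : ℕ} (hk : 0 < k) {x y : ℝ} (hx : x ∈ quarterCell k i)
    (hy : y ∈ quarterCell k j) :
    (i = j → k * |x - y| ≤ 1 / 4) ∧ (i ≠ j → 3 / 4 ≤ k * |x - y|) := by
  have hk' : (0 : ℝ) < k := by exact_mod_cast hk
  obtain ⟨hx1, hx2⟩ := hx
  obtain ⟨hy1, hy2⟩ := hy
  rw [div_le_iff₀ hk'] at hx1 hy1
  rw [lt_div_iff₀ hk'] at hx2 hy2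
  have habs : k * |x - y| = |x * k - y * k| := by
    rw [← sub_mul, abs_mul, abs_of_pos hk', mul_comm]
  rw [habs]
  constructor
  · rintro rfl
    rw [abs_le]
    constructor <;> linarith
  · intro hij
    rcases lt_or_gt_of_ne hij with h | h
    · have h1 : (i : ℝ) + 1 ≤ j := by exact_mod_cast h
      rw [abs_sub_comm]
      exact le_trans (by linarith) (le_abs_self _)
    · have h1 : (j : ℝ) + 1 ≤ i := by exact_mod_cast h
      exact le_trans (by linarith) (le_abs_self _)

theorem eq_of_mem_quarterCell {k i j : ℕ} (hk : 0 < k) {x : ℝ} (hx : x ∈ quarterCell k i)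
    (hx' : x ∈ quarterCell k j) : i = j := by
  by_contra hij
  have := (abs_sub_of_mem_quarterCell hk hx hx').2 hij
  norm_num at this

theorem sum_mul_indicator_quarterCell {k : ℕ} (hk : 0 < k) (c : Fin k → ℝ) {x : ℝ} {i : Fin k}
    (hx : x ∈ quarterCell k i) : ∑ j, c j * (quarterCell k j).indicator 1 x = c i := by
  rw [Finset.sum_eq_single i]
  · simp [hx]
  · intro j _ hj
    rw [Set.indicator_of_notMem, mul_zero]
    exact fun h => hj (Fin.ext (eq_of_mem_quarterCell hk h hx))
  · simp

theorem measurable_quarterStep {k : ℕ} (c : Fin k → ℝ) : Measurable (quarterStep k c) := by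
  have h : quarterStep k c = fun x => ∑ i, c i * (quarterCell k i).indicator 1 x :=
    funext (quarterStep_apply c)
  rw [h]
  refine Finset.measurable_fun_sum _ fun i _ => Measurable.const_mul ?_ _
  exact measurable_one.indicator measurableSet_Ico

theorem abs_quarterStep_le {k : ℕ} (c : Fin k → ℝ) (x : ℝ) : |quarterStep k c x| ≤ ∑ i, |c i| := by
  rw [quarterStep_apply]
  refine (Finset.abs_sum_le_sum_abs _ _).trans (Finset.sum_le_sum fun i _ => ?_)
  rw [abs_mul]
  refine mul_le_of_le_one_right (abs_nonneg _) ?_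
  by_cases h : x ∈ quarterCell k i <;> simp [h]

theorem quarterStep_sq {k : ℕ} (hk : 0 < k) (c : Fin k → ℝ) (x : ℝ) :
    quarterStep k c x ^ 2 = ∑ i, c i ^ 2 * (quarterCell k i).indicator 1 x := by
  rw [quarterStep_apply]
  by_cases h : ∃ i : Fin k, x ∈ quarterCell k i
  · obtain ⟨i, hi⟩ := h
    rw [sum_mul_indicator_quarterCell hk c hi, sum_mul_indicator_quarterCell hk (fun j => c j ^ 2) hi]
  · have : ∀ i : Fin k, (quarterCell k i).indicator (1 : ℝ → ℝ) x = 0 := fun i =>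
      Set.indicator_of_notMem (fun hi => h ⟨i, hi⟩) _
    simp [this]

theorem integrable_indicator_quarterCell (k i : ℕ) :
    Integrable (fun x => (quarterCell k i).indicator (1 : ℝ → ℝ) x) unitLebesgue :=
  (integrable_const (1 : ℝ)).indicator measurableSet_Ico

theorem integral_indicator_quarterCell {k : ℕ} (hk : 0 < k) (i : Fin k) :
    ∫ x, (quarterCell k i).indicator (1 : ℝ → ℝ) x ∂unitLebesgue = 1 / (4 * k) := by
  have hk' : (0 : ℝ) < k := by exact_mod_cast hk
  have hsub : quarterCell k i ⊆ Set.Icc 0 1 := fun x hx => by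
    refine ⟨le_trans (by positivity) hx.1, hx.2.le.trans ?_⟩
    rw [div_le_one hk']
    have : (i : ℝ) + 1 ≤ k := by exact_mod_cast i.2
    linarith
  have hmeas : MeasurableSet (quarterCell k i) := measurableSet_Ico
  rw [integral_indicator_one hmeas, unitLebesgue, measureReal_restrict_apply hmeas,
    Set.inter_eq_left.2 hsub, quarterCell, Real.volume_real_Ico_of_le (by gcongr; linarith)]
  field_simp
  ring

theorem integral_quarterStep_sq {k : ℕ} (hk : 0 < k) (c : Fin k → ℝ) :
    ∫ x, quarterStep k c x ^ 2 ∂unitLebesgue = (∑ i, c i ^ 2) * (1 / (4 * k)) := by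
  simp_rw [quarterStep_sq hk]
  rw [integral_finsetSum _ fun (i : Fin k) _ => (integrable_indicator_quarterCell k i).const_mul _,
    Finset.sum_mul]
  exact Finset.sum_congr rfl fun i _ => by
    rw [integral_const_mul, integral_indicator_quarterCell hk]

/-- At parameter `4k`, points of one quarter cell have scaled distance at most `1`, giving the
factor `exp (-1)`. Points of different cells have scaled distance at least `3`, so half of the
exponent yields `exp (-9/2)` and the other half remains as a Gaussian of parameter `4k / √2`, to be
summed by Schur's bound. -/
theorem gaussian_mul_quarterStep_ge {k : ℕ} (hk : 0 < k) (c : Fin k → ℝ) (x y : ℝ) :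
    Real.exp (-1) * (∑ i, c i ^ 2 * ((quarterCell k i).indicator 1 x *
        (quarterCell k i).indicator 1 y)) -
      Real.exp (-(9 / 2)) * (Real.exp (-((4 * k / √2) ^ 2 * (x - y) ^ 2)) *
        ((quarterStep k c x ^ 2 + quarterStep k c y ^ 2) / 2)) ≤
      Real.exp (-((4 * k) ^ 2 * (x - y) ^ 2)) * (quarterStep k c x * quarterStep k c y) := by
  have h0 : 0 ≤ Real.exp (-(9 / 2)) * (Real.exp (-((4 * k / √2) ^ 2 * (x - y) ^ 2)) *
        ((quarterStep k c x ^ 2 + quarterStep k c y ^ 2) / 2)) := by positivity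
  have hdiv : (4 * k / √2) ^ 2 = ((4 * k) ^ 2 / 2 : ℝ) := by
    rw [div_pow, Real.sq_sqrt (by norm_num)]
  have hsq : ((4 * k) ^ 2 * (x - y) ^ 2 : ℝ) = 16 * (k * |x - y|) ^ 2 := by
    rw [mul_pow _ |x - y|, sq_abs]; ring
  by_cases hx : ∃ i : Fin k, x ∈ quarterCell k i
  swap
  · have h1 : ∀ i : Fin k, (quarterCell k i).indicator (1 : ℝ → ℝ) x = 0 := fun i =>
      Set.indicator_of_notMem (fun hi => hx ⟨i, hi⟩) _
    have h2 : quarterStep k c x = 0 := by simp [quarterStep_apply, h1]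
    simp only [h1, h2] at h0 ⊢
    simpa using h0
  by_cases hy : ∃ i : Fin k, y ∈ quarterCell k i
  swap
  · have h1 : ∀ i : Fin k, (quarterCell k i).indicator (1 : ℝ → ℝ) y = 0 := fun i =>
      Set.indicator_of_notMem (fun hi => hy ⟨i, hi⟩) _
    have h2 : quarterStep k c y = 0 := by simp [quarterStep_apply, h1]
    simp only [h1, h2] at h0 ⊢
    simpa using h0
  obtain ⟨i, hi⟩ := hx
  obtain ⟨j, hj⟩ := hy
  have hsx : quarterStep k c x = c i := by
    rw [quarterStep_apply, sum_mul_indicator_quarterCell hk c hi]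
  have hsy : quarterStep k c y = c j := by
    rw [quarterStep_apply, sum_mul_indicator_quarterCell hk c hj]
  have hdist := abs_sub_of_mem_quarterCell hk hi hj
  have hP : ∑ m, c m ^ 2 * ((quarterCell k m).indicator 1 x * (quarterCell k m).indicator 1 y) =
      c i ^ 2 * (quarterCell k i).indicator 1 y := by
    simp_rw [mul_comm ((quarterCell k _).indicator 1 x), ← mul_assoc]
    exact sum_mul_indicator_quarterCell hk
      (fun m => c m ^ 2 * (quarterCell k m).indicator 1 y) hi
  rw [hP]
  by_cases hij : i = j
  · subst hij
    have h3 := hdist.1 rfl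
    have h4 : 0 ≤ (k : ℝ) * |x - y| := by positivity
    rw [hsx, hsy] at h0 ⊢
    rw [Set.indicator_of_mem hj, Pi.one_apply, mul_one, ← sq (c i)]
    have h5 : Real.exp (-1) ≤ Real.exp (-((4 * k) ^ 2 * (x - y) ^ 2)) := by
      rw [Real.exp_le_exp, hsq]; nlinarith
    have h6 := mul_le_mul_of_nonneg_right h5 (sq_nonneg (c i))
    linarith
  · have hne : (i : ℕ) ≠ j := fun h => hij (Fin.ext h)
    have h3 := hdist.2 hne
    rw [Set.indicator_of_notMem (fun h => hne (eq_of_mem_quarterCell hk h hj)), mul_zero, mul_zero,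
      zero_sub, ← mul_assoc, hdiv, div_mul_eq_mul_div, hsq, hsx, hsy]
    have h4 : Real.exp (-(16 * (k * |x - y|) ^ 2)) ≤
        Real.exp (-(9 / 2)) * Real.exp (-(16 * (k * |x - y|) ^ 2 / 2)) := by
      rw [← Real.exp_add, Real.exp_le_exp]; nlinarith
    have h5 : -((c i ^ 2 + c j ^ 2) / 2) ≤ c i * c j := by nlinarith [sq_nonneg (c i + c j)]
    have h6 : 0 ≤ (c i ^ 2 + c j ^ 2) / 2 := by positivity
    have h7 := mul_le_mul_of_nonneg_left h5 (Real.exp_pos (-(16 * (k * |x - y|) ^ 2))).le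
    have h8 := mul_le_mul_of_nonneg_right h4 h6
    linarith

theorem gaussianEnergy_quarterStep_ge {k : ℕ} (hk : 0 < k) (c : Fin k → ℝ) :
    (Real.exp (-1) - Real.exp (-(9 / 2)) * (√2 * √Real.pi)) * ∫ x, quarterStep k c x ^ 2 ∂unitLebesgue ≤
      4 * k * gaussianEnergy unitLebesgue (quarterStep k c) (4 * k) := by
  have hk' : (0 : ℝ) < k := by exact_mod_cast hk
  have hm := measurable_quarterStep c
  have hM := abs_quarterStep_le c
  set Q := ∫ x, quarterStep k c x ^ 2 ∂unitLebesgue with hQ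
  have hi1 : ∀ i : Fin k, Integrable (fun z : ℝ × ℝ => (quarterCell k i).indicator (1 : ℝ → ℝ) z.1 *
      (quarterCell k i).indicator (1 : ℝ → ℝ) z.2) (unitLebesgue.prod unitLebesgue) := fun i =>
    (integrable_indicator_quarterCell k i).mul_prod (integrable_indicator_quarterCell k i)
  have hi2 : Integrable (fun z : ℝ × ℝ => ∑ i : Fin k, c i ^ 2 *
      ((quarterCell k i).indicator (1 : ℝ → ℝ) z.1 * (quarterCell k i).indicator (1 : ℝ → ℝ) z.2))
      (unitLebesgue.prod unitLebesgue) :=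
    integrable_finsetSum _ fun i _ => (hi1 i).const_mul _
  have hdiag : ∫ z : ℝ × ℝ, ∑ i : Fin k, c i ^ 2 *
      ((quarterCell k i).indicator (1 : ℝ → ℝ) z.1 * (quarterCell k i).indicator (1 : ℝ → ℝ) z.2)
      ∂(unitLebesgue.prod unitLebesgue) = 1 / (4 * k) * Q := by
    rw [integral_finsetSum _ fun i _ => (hi1 i).const_mul _, hQ, integral_quarterStep_sq hk,
      Finset.sum_mul, Finset.mul_sum]
    refine Finset.sum_congr rfl fun i _ => ?_
    rw [integral_const_mul, integral_prod_mul (fun x => (quarterCell k i).indicator (1 : ℝ → ℝ) x)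
      (fun x => (quarterCell k i).indicator (1 : ℝ → ℝ) x), integral_indicator_quarterCell hk]
    ring
  have hi3 := integrable_gaussian_mul_sq (ν := unitLebesgue) hm hM (4 * k / √2)
  have hoff := integral_gaussian_mul_sq_le (ν := unitLebesgue) hm hM le_rfl
    (b := 4 * k / √2) (by positivity)
  have hE := integral_mono (μ := unitLebesgue.prod unitLebesgue)
    ((hi2.const_mul (Real.exp (-1))).sub (hi3.const_mul (Real.exp (-(9 / 2)))))
    (integrable_bounded_mul_prod hm hM
      (k := fun z => Real.exp (-((4 * k) ^ 2 * (z.1 - z.2) ^ 2))) (by fun_prop) (B := 1) fun z => by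
        rw [abs_of_pos (Real.exp_pos _), Real.exp_le_one_iff]
        exact neg_nonpos.2 (by positivity))
    fun z => gaussian_mul_quarterStep_ge hk c z.1 z.2
  simp only [Pi.sub_apply] at hE
  rw [integral_sub (hi2.const_mul _) (hi3.const_mul _), integral_const_mul, integral_const_mul,
    hdiag] at hE
  change _ ≤ gaussianEnergy unitLebesgue (quarterStep k c) (4 * k) at hE
  have h1 := mul_le_mul_of_nonneg_left hoff (Real.exp_pos (-(9 / 2))).le
  have h2 : Real.exp (-1) * (1 / (4 * k) * Q) -
      Real.exp (-(9 / 2)) * (√Real.pi / (4 * k / √2) * Q) ≤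
      gaussianEnergy unitLebesgue (quarterStep k c) (4 * k) := by linarith
  have h3 := mul_le_mul_of_nonneg_left h2 (by positivity : (0 : ℝ) ≤ 4 * k)
  refine le_trans (le_of_eq ?_) h3
  field_simp

theorem quarter_le_energy_constant :
    (1 / 4 : ℝ) ≤ Real.exp (-1) - Real.exp (-(9 / 2)) * (√2 * √Real.pi) -
      Real.exp (-12) * √Real.pi := by
  have h1 : (0.36 : ℝ) ≤ Real.exp (-1) := by
    have := Real.exp_neg_one_gt_d9
    linarith
  have h2 : Real.exp (-1) ≤ 0.37 := by
    have := Real.exp_neg_one_lt_d9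
    linarith
  have h3 : Real.exp (-4) ≤ 0.019 := by
    have : Real.exp (-4) = Real.exp (-1) ^ 4 := by rw [← Real.exp_nat_mul]; norm_num
    rw [this]
    exact (pow_le_pow_left₀ (Real.exp_pos _).le h2 4).trans (by norm_num)
  have h4 : Real.exp (-(9 / 2)) ≤ 0.019 := le_trans (Real.exp_le_exp.2 (by norm_num)) h3
  have h5 : Real.exp (-12) ≤ 0.019 := le_trans (Real.exp_le_exp.2 (by norm_num)) h3
  have h6 : √2 ≤ 1.5 := by rw [Real.sqrt_le_left (by norm_num)]; norm_num
  have h7 : √Real.pi ≤ 1.8 := by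
    rw [Real.sqrt_le_left (by norm_num)]
    have := Real.pi_lt_d2
    norm_num at this ⊢
    linarith
  have h8 : √2 * √Real.pi ≤ 1.5 * 1.8 := mul_le_mul h6 h7 (Real.sqrt_nonneg _) (by norm_num)
  have h9 : Real.exp (-(9 / 2)) * (√2 * √Real.pi) ≤ 0.019 * (1.5 * 1.8) :=
    mul_le_mul h4 h8 (by positivity) (by norm_num)
  have h10 : Real.exp (-12) * √Real.pi ≤ 0.019 * 1.8 :=
    mul_le_mul h5 h7 (by positivity) (by norm_num)
  norm_num at h9 h10 ⊢
  linarith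

/-- At parameter `4k` the quarter-cell step functions are almost decoupled, so their energy is
bounded below. Frequencies with `t² ≤ R` carry this over to parameter `a` at the cost `exp (-R / (4
a²))`, and the energy at `8k` controls the remaining frequencies. `R = 1024 k²` makes that error
`exp (-12)` and the cost `exp (-256 (k/a)²)`. Passing from `1/4` to `1/5` gives the strict
inequality required by the dual criterion. -/
theorem hasSpectralSubspace_unitLebesgue {a : ℝ} (ha : 0 < a) {k : ℕ} (hk : 0 < k) :
    HasSpectralSubspace unitLebesgue a k (1 / 5 / a * Real.exp (-(256 * (k / a) ^ 2))) := by
  have hk' : (0 : ℝ) < k := by exact_mod_cast hk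
  refine hasSpectralSubspace_of_dual unitLebesgue_compl_Icc
    (l' := 1 / 4 / a * Real.exp (-(256 * (k / a) ^ 2))) (by positivity) ?_ (quarterStep k)
    measurable_quarterStep (fun c => ⟨_, abs_quarterStep_le c⟩) (fun c hc => ?_) fun c => ?_
  · refine mul_lt_mul_of_pos_right ?_ (Real.exp_pos _)
    gcongr
    norm_num
  · rw [integral_quarterStep_sq hk]
    refine mul_pos ?_ (by positivity)
    obtain ⟨i, hi⟩ := Function.ne_iff.1 hc
    refine Finset.sum_pos' (fun i _ => sq_nonneg _) ⟨i, Finset.mem_univ _, ?_⟩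
    have : c i ≠ 0 := hi
    positivity
  · have hm := measurable_quarterStep c
    have hM := abs_quarterStep_le c
    set Q := ∫ x, quarterStep k c x ^ 2 ∂unitLebesgue
    have hQ : 0 ≤ Q := integral_nonneg fun _ => sq_nonneg _
    have h1 := gaussianEnergy_comparison (ν := unitLebesgue) hm hM ha (b := 4 * k) (b' := 8 * k)
      (by positivity) (by linarith) (1024 * k ^ 2)
    have h2 := gaussianEnergy_le (ν := unitLebesgue) hm hM le_rfl (b := 8 * k) (by positivity)
    have h3 := gaussianEnergy_quarterStep_ge hk c
    have h4 : (1 / (4 * (4 * k : ℝ) ^ 2) - 1 / (4 * (8 * k : ℝ) ^ 2)) * (1024 * k ^ 2) = 12 := by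
      field_simp; norm_num
    have h5 : 1 / (4 * a ^ 2) * (1024 * (k : ℝ) ^ 2) = 256 * (k / a) ^ 2 := by
      field_simp; norm_num
    rw [h4, h5] at h1
    have h6 := mul_le_mul_of_nonneg_left h2 (Real.exp_pos (-12)).le
    have h7 : 1 / 4 * Q ≤ 4 * k * gaussianEnergy unitLebesgue (quarterStep k c) (4 * k) -
        Real.exp (-12) * (8 * k * gaussianEnergy unitLebesgue (quarterStep k c) (8 * k)) := by
      have := mul_le_mul_of_nonneg_right quarter_le_energy_constant hQ
      linarith
    have h8 := (mul_le_mul_of_nonneg_left h7 (Real.exp_pos (-(256 * (k / a) ^ 2))).le).trans h1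
    change _ ≤ gaussianEnergy unitLebesgue (quarterStep k c) a
    rw [← mul_le_mul_iff_right₀ ha]
    refine le_trans (le_of_eq ?_) h8
    field_simp

/-! ### The entropy bound -/

/-- Outside the range `100 ≤ a`, `k ≤ c a` one has `k / a ≥ τ`. There the lost factor `c₀ / 5 ≥ exp
(-D)` is absorbed because `D ≤ (D / τ²) (k/a)²`, leaving the prefactor `1 / a` intact. -/
theorem IsDesignDensity.exists_spectralSubspace {c₀ : ℝ} (hc₀ : 0 < c₀) {μ : I → ℝ}
    (hμ : IsDesignDensity c₀ μ) : ∃ B : ℝ, 0 < B ∧ ∀ (a : ℝ) (k : ℕ), 0 < a → 0 < k →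
      HasSpectralSubspace (realLaw μ) a k (1 / a * Real.exp (-(B * (k / a) ^ 2))) := by
  obtain ⟨c, hc, hlin⟩ := hμ.exists_spectralSubspace_linear
  set D := |Real.log (c₀ / 5)|
  have hD : 0 ≤ D := abs_nonneg _
  set τ := min c (1 / 100)
  have hτ : 0 < τ := lt_min hc (by norm_num)
  refine ⟨256 + D / τ ^ 2, by positivity, fun a k ha hk => ?_⟩
  have hk1 : (1 : ℝ) ≤ k := by exact_mod_cast hk
  by_cases h : 100 ≤ a ∧ (k : ℝ) ≤ c * a
  · refine (hlin a k h.1 h.2).mono le_rfl (mul_le_of_le_one_right (by positivity) ?_)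
    rw [Real.exp_le_one_iff]
    exact neg_nonpos.2 (by positivity)
  · have hτk : τ ≤ k / a := by
      rw [le_div_iff₀ ha]
      by_cases h1 : 100 ≤ a
      · have h2 : c * a < k := not_le.1 fun h3 => h ⟨h1, h3⟩
        exact (mul_le_mul_of_nonneg_right (min_le_left _ _) ha.le).trans h2.le
      · have h2 := mul_le_mul_of_nonneg_right (min_le_right c (1 / 100)) ha.le
        linarith
    refine ((hasSpectralSubspace_unitLebesgue ha hk).of_unitLebesgue hc₀ hμ).mono le_rfl ?_
    have h3 : D ≤ D / τ ^ 2 * (k / a) ^ 2 := by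
      rw [div_mul_eq_mul_div, le_div_iff₀ (by positivity)]
      exact mul_le_mul_of_nonneg_left (pow_le_pow_left₀ hτ.le hτk 2) hD
    have h4 : Real.exp (-D) ≤ c₀ / 5 := by
      rw [← Real.le_log_iff_exp_le (by positivity)]
      exact neg_abs_le _
    have h5 : Real.exp (-((256 + D / τ ^ 2) * (k / a) ^ 2)) ≤
        c₀ / 5 * Real.exp (-(256 * (k / a) ^ 2)) := by
      refine le_trans ?_ (mul_le_mul_of_nonneg_right h4 (Real.exp_pos _).le)
      rw [← Real.exp_add, Real.exp_le_exp]
      linarith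
    refine (mul_le_mul_of_nonneg_left h5 (by positivity)).trans (le_of_eq ?_)
    ring

/-- For `l = a⁻¹ exp (-E)` the exponent `(d/2) log l - log ε` equals `L - d E / 2`, and the budget
`d E ≤ L` keeps half of `L`. -/
theorem HasSpectralSubspace.pow_mul_half_le_log {c₀ : ℝ} {μ : I → ℝ}
    (hμ : IsDesignDensity c₀ μ) {p : ℕ} (J : Finset (Fin p)) {a E L : ℝ} (ha : 0 < a) {k : ℕ}
    (h : HasSpectralSubspace (realLaw μ) a k (1 / a * Real.exp (-E))) {ε : ℝ≥0} (hε : 0 < ε)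
    (hL : L = -Real.log ε - J.card / 2 * Real.log a) (hE : J.card * E ≤ L) :
    (((k : ℝ) ^ J.card * (L / 2) : ℝ) : EReal) ≤
      ENNReal.log ((designCoveringNumber μ J a ε : ℕ∞) : ℝ≥0∞) := by
  refine le_trans (EReal.coe_le_coe_iff.2 ?_)
    (log_le_log_designCoveringNumber hμ J (by positivity) h hε)
  refine mul_le_mul_of_nonneg_left ?_ (by positivity)
  rw [Real.log_mul (by positivity) (Real.exp_pos _).ne', Real.log_exp, one_div, Real.log_inv]
  rw [hL] at hE ⊢
  linarith

theorem rpow_half_add_two {L : ℝ} (hL : 0 < L) (d : ℕ) :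
    L ^ (((d : ℝ) + 2) / 2) = √L ^ d * L := by
  rw [add_div, div_self two_ne_zero, Real.rpow_add hL, Real.rpow_one, Real.sqrt_eq_rpow,
    ← Real.rpow_natCast, ← Real.rpow_mul hL.le]
  congr 2
  ring

/-- For `d > 0`, `B d = d² (B/d)` and `B/d ≤ exp (B/d)`; the `d`-th power of the square root costs
only `exp (B/2)`, uniformly in `d`. -/
theorem sqrt_mul_pow_le {B : ℝ} (hB : 0 < B) (d : ℕ) :
    √(B * d) ^ d ≤ (d : ℝ) ^ d * Real.exp (B / 2) := by
  rcases Nat.eq_zero_or_pos d with rfl | hd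
  · simpa using (half_pos hB).le
  have hd' : (0 : ℝ) < d := by exact_mod_cast hd
  have h1 : √(B * d) ≤ d * Real.exp (B / (2 * d)) := by
    rw [Real.sqrt_le_left (by positivity), mul_pow, ← Real.exp_nat_mul]
    have h2 := Real.add_one_le_exp (B / d)
    have h3 : ((2 : ℕ) : ℝ) * (B / (2 * d)) = B / d := by push_cast; field_simp
    have h4 : B * d = (d : ℝ) ^ 2 * (B / d) := by field_simp
    rw [h3, h4]
    exact mul_le_mul_of_nonneg_left (by linarith) (by positivity)
  refine (pow_le_pow_left₀ (Real.sqrt_nonneg _) h1 d).trans (le_of_eq ?_)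
  rw [mul_pow, ← Real.exp_nat_mul]
  congr 2
  field_simp

theorem entropy_rate_le {B a L : ℝ} (hB : 0 < B) (ha : 0 < a) (hL : 0 < L) (d : ℕ) :
    Real.exp (-(B / 2)) / 2 * (a ^ d / (d : ℝ) ^ d) * L ^ (((d : ℝ) + 2) / 2) ≤
      (a * √(L / (B * d))) ^ d * (L / 2) := by
  rw [rpow_half_add_two hL, Real.sqrt_div hL.le, mul_pow, div_pow]
  have hdd : (0 : ℝ) < (d : ℝ) ^ d := by
    rcases Nat.eq_zero_or_pos d with rfl | hd
    · simp
    · positivity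
  have hsd : 0 < √(B * d) ^ d := by
    rcases Nat.eq_zero_or_pos d with rfl | hd
    · simp
    · positivity
  have h1 : Real.exp (-(B / 2)) / (d : ℝ) ^ d ≤ 1 / √(B * d) ^ d := by
    rw [div_le_div_iff₀ hdd hsd, one_mul]
    have h2 := mul_le_mul_of_nonneg_left (sqrt_mul_pow_le hB d) (Real.exp_pos (-(B / 2))).le
    refine h2.trans (le_of_eq ?_)
    rw [mul_left_comm, ← Real.exp_add]
    simp
  have h3 := mul_le_mul_of_nonneg_right h1 (by positivity : 0 ≤ a ^ d * (√L ^ d * (L / 2)))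
  refine le_trans (le_of_eq ?_) (h3.trans (le_of_eq ?_))
  · field_simp
  · field_simp

/-- The decay of order `d^(-d/2)` beats every exponential in `d`: the stray factor `d` is bounded by
`e^d`, and `3 e` enters the square root, which replaces `B` by `9 e² B`. -/
theorem bounded_entropy_rate {B a L : ℝ} (hB : 0 < B) (ha : 0 < a) (ha3 : a ≤ 3) (hL : 0 < L)
    {d : ℕ} (hLd : L ≤ B * d) :
    (a ^ d / (d : ℝ) ^ d) * L ^ (((d : ℝ) + 2) / 2) ≤ B * Real.exp (9 * Real.exp 2 * B / 2) := by
  have hd : (0 : ℝ) < d := by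
    by_contra h
    have := mul_nonneg hB.le (not_lt.1 h |> neg_nonneg.2)
    linarith
  rw [rpow_half_add_two hL]
  have h1 : √L ^ d * L ≤ √(B * d) ^ d * (B * d) := by gcongr
  have h2 : a ^ d ≤ 3 ^ d := by gcongr
  have h3 : (3 : ℝ) ^ d * √(B * d) ^ d * Real.exp d = √(9 * Real.exp 2 * B * d) ^ d := by
    have h4 : √(9 * Real.exp 2 * B * d) = 3 * Real.exp 1 * √(B * d) := by
      have h5 : 9 * Real.exp 2 * B * d = (3 * Real.exp 1) ^ 2 * (B * d) := by
        rw [mul_pow, ← Real.exp_nat_mul]; norm_num; ring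
      rw [h5, Real.sqrt_mul (by positivity), Real.sqrt_sq (by positivity)]
    rw [h4, mul_pow, mul_pow, ← Real.exp_nat_mul, mul_one]
    ring
  have h6 := sqrt_mul_pow_le (B := 9 * Real.exp 2 * B) (by positivity) d
  rw [← h3] at h6
  have h7 : (d : ℝ) ≤ Real.exp d := by linarith [Real.add_one_le_exp (d : ℝ)]
  have hdd : (0 : ℝ) < (d : ℝ) ^ d := by positivity
  rw [div_mul_eq_mul_div, div_le_iff₀ hdd]
  calc a ^ d * (√L ^ d * L) ≤ 3 ^ d * (√(B * d) ^ d * (B * d)) := by gcongr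
    _ = B * (3 ^ d * √(B * d) ^ d * d) := by ring
    _ ≤ B * (3 ^ d * √(B * d) ^ d * Real.exp d) := by gcongr
    _ ≤ B * ((d : ℝ) ^ d * Real.exp (9 * Real.exp 2 * B / 2)) := by gcongr
    _ = _ := by ring

theorem log_two_le_log_of_two_le {N : ℕ∞} (hN : 2 ≤ N) :
    ((Real.log 2 : ℝ) : EReal) ≤ ENNReal.log ((N : ℕ∞) : ℝ≥0∞) := by
  have h1 : ((Real.log 2 : ℝ) : EReal) = ENNReal.log 2 := by
    rw [← ENNReal.log_ofReal_of_pos two_pos]; simp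
  rw [h1]
  exact ENNReal.log_monotone (by exact_mod_cast hN)

theorem two_le_of_log_pos {N : ℕ∞} {r : ℝ} (hr : 0 < r)
    (h : (r : EReal) ≤ ENNReal.log ((N : ℕ∞) : ℝ≥0∞)) : 2 ≤ N := by
  have h1 : ENNReal.log 1 < ENNReal.log ((N : ℕ∞) : ℝ≥0∞) := by
    rw [ENNReal.log_one]
    exact lt_of_lt_of_le (by exact_mod_cast hr) h
  have h2 : (1 : ℝ≥0∞) < ((N : ℕ∞) : ℝ≥0∞) := ENNReal.log_strictMono.lt_iff_lt.1 h1
  have h3 : (1 : ℕ∞) < N := by exact_mod_cast h2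
  have := Order.add_one_le_of_lt h3
  rwa [one_add_one_eq_two] at this

theorem two_le_of_ne_one {N : ℕ∞} {r : ℝ}
    (h : (r : EReal) ≤ ENNReal.log ((N : ℕ∞) : ℝ≥0∞)) (hN : N ≠ 1) : 2 ≤ N := by
  have h0 : N ≠ 0 := by
    rintro rfl
    simp at h
  have h1 : (1 : ℕ∞) < N := lt_of_le_of_ne (Order.one_le_iff_pos.2 (pos_iff_ne_zero.2 h0)) hN.symm
  have := Order.add_one_le_of_lt h1
  rwa [one_add_one_eq_two] at this

theorem mainTheorem10 (c₀ : ℝ) (hc₀ : 0 < c₀) (μ : unitInterval → ℝ)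
    (hμ : IsDesignDensity c₀ μ) :
    ∃ C : ℝ, 0 < C ∧
      ∀ (p : ℕ) (J : Finset (Fin p)) (a : ℝ) (ε : ℝ≥0), 2 ≤ a → 0 < ε →
        (ε : ℝ) < a ^ (-(J.card : ℝ) / 2) →
        (3 ≤ a ∨ (ε : ℝ) < (c₀ / a) ^ ((J.card : ℝ) / 2) ∨ designCoveringNumber μ J a ε ≠ 1) →
        ((C * (a ^ J.card / (J.card : ℝ) ^ J.card) *
            Real.log (1 / (ε * a ^ ((J.card : ℝ) / 2))) ^ (((J.card : ℝ) + 2) / 2) : ℝ) : EReal) ≤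
          ENNReal.log ((designCoveringNumber μ J a ε : ℕ∞) : ℝ≥0∞) := by

  obtain ⟨B, hB, hspec⟩ := hμ.exists_spectralSubspace hc₀
  have := hμ.isProbabilityMeasure_realLaw
  have hB4 : 0 < 4 * B := by positivity
  -- The bound of `bounded_entropy_rate` for `4 B`. Dividing `log 2` by it lets `N ≥ 2` suffice when
  -- `a < 3` and `L < 4 B d`.
  set W := 4 * B * Real.exp (9 * Real.exp 2 * (4 * B) / 2)
  have hW : 0 < W := by positivity
  have hlog2 : 0 < Real.log 2 := Real.log_pos one_lt_two
  refine ⟨min (Real.exp (-(4 * B / 2)) / 2) (Real.log 2 / W), by positivity,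
    fun p J a ε ha hε hεa hcase => ?_⟩
  set d := J.card
  have ha0 : 0 < a := by linarith
  have hε' : (0 : ℝ) < ε := hε
  set L := Real.log (1 / (ε * a ^ ((d : ℝ) / 2)))
  have hLeq : L = -Real.log ε - d / 2 * Real.log a := by
    simp only [L]
    rw [one_div, Real.log_inv, Real.log_mul hε'.ne' (by positivity), Real.log_rpow ha0]
    ring
  have hL : 0 < L := by
    have := Real.log_lt_log hε' hεa
    rw [Real.log_rpow ha0] at this
    rw [hLeq]
    linarith
  have hX : 0 ≤ a ^ d / (d : ℝ) ^ d * L ^ (((d : ℝ) + 2) / 2) := by positivity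
  -- The target value of `k / a`. The `4` leaves room for `k = m + 1 ≤ 2 a t`. For `d = 0` the
  -- quotient is `0` by convention, so `t = 0`.
  set t := √(L / (4 * B * d))
  have ht : 0 ≤ t := Real.sqrt_nonneg _
  have hdt : d * (4 * B * t ^ 2) ≤ L := by
    rcases Nat.eq_zero_or_pos d with hd | hd
    · rw [hd]; simpa using hL.le
    · have hd' : (0 : ℝ) < d := by exact_mod_cast hd
      rw [Real.sq_sqrt (by positivity)]
      refine le_of_eq ?_
      field_simp
  -- The dimension used is `m + 1`: at least `a t`, as the rate requires, and never zero.
  set m := ⌊a * t⌋₊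
  have hm : (m : ℝ) ≤ a * t := Nat.floor_le (by positivity)
  have hm' : a * t ≤ ((m + 1 : ℕ) : ℝ) := by
    push_cast
    exact (Nat.lt_floor_add_one _).le
  have hmt : (m / a : ℝ) ≤ t := by rwa [div_le_iff₀ ha0, mul_comm]
  have hrate : min (Real.exp (-(4 * B / 2)) / 2) (Real.log 2 / W) * (a ^ d / (d : ℝ) ^ d) *
      L ^ (((d : ℝ) + 2) / 2) ≤ ((m + 1 : ℕ) : ℝ) ^ d * (L / 2) := by
    rw [mul_assoc]
    refine (mul_le_mul_of_nonneg_right (min_le_left _ _) hX).trans ?_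
    rw [← mul_assoc]
    refine (entropy_rate_le hB4 ha0 hL d).trans ?_
    gcongr
  have hbig : ∀ E, HasSpectralSubspace (realLaw μ) a (m + 1) (1 / a * Real.exp (-E)) →
      d * E ≤ L → ((min (Real.exp (-(4 * B / 2)) / 2) (Real.log 2 / W) *
        (a ^ d / (d : ℝ) ^ d) * L ^ (((d : ℝ) + 2) / 2) : ℝ) : EReal) ≤
          ENNReal.log ((designCoveringNumber μ J a ε : ℕ∞) : ℝ≥0∞) := fun E hE hdE =>
    (EReal.coe_le_coe_iff.2 hrate).trans (hE.pow_mul_half_le_log hμ J ha0 hε hLeq hdE)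
  rcases le_or_gt 3 a with ha3 | ha3
  · refine hbig (4 * B * (m / a) ^ 2) ?_ ?_
    -- If `m = 0` the exponent must vanish, and the constant density supplies exactly `1 / a`. If `m
    -- ≥ 1`, then `m + 1 ≤ 2 m` and the factor `4` absorbs the rounding.
    · rcases Nat.eq_zero_or_pos m with hm0 | hm0
      · rw [hm0]
        simpa using hasSpectralSubspace_one_of_three_le (realLaw_compl_Icc μ) ha3
      · refine (hspec a (m + 1) ha0 (Nat.succ_pos _)).mono le_rfl ?_
        have h1 : ((m + 1 : ℕ) : ℝ) / a ≤ 2 * (m / a) := by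
          rw [← mul_div_assoc]
          gcongr
          have : (1 : ℝ) ≤ m := by exact_mod_cast hm0
          push_cast; linarith
        have h2 := pow_le_pow_left₀ (by positivity) h1 2
        refine mul_le_mul_of_nonneg_left (Real.exp_le_exp.2 (neg_le_neg ?_)) (by positivity)
        nlinarith
    · refine le_trans ?_ hdt
      gcongr
  -- If `L ≥ 4 B d` with `d > 0`, then `t ≥ 1` and `a t + 1 ≤ 2 a t`, so rounding is harmless; `d =
  -- 0` also falls here. Otherwise the target is at most `log 2`, and only `N ≥ 2` remains.
  · rcases le_or_gt (4 * B * d) L with hLd | hLd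
    · refine hbig (B * (((m + 1 : ℕ) : ℝ) / a) ^ 2) (hspec a (m + 1) ha0 (Nat.succ_pos _)) ?_
      rcases Nat.eq_zero_or_pos d with hd | hd
      · rw [hd]; simpa using hL.le
      · have hd' : (0 : ℝ) < d := by exact_mod_cast hd
        have ht1 : 1 ≤ t := by
          rw [Real.one_le_sqrt, one_le_div (by positivity)]
          exact hLd
        have h1 : ((m + 1 : ℕ) : ℝ) / a ≤ 2 * t := by
          rw [div_le_iff₀ ha0]
          push_cast
          nlinarith
        have h2 := pow_le_pow_left₀ (by positivity) h1 2
        refine le_trans ?_ hdt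
        refine mul_le_mul_of_nonneg_left ?_ hd'.le
        nlinarith
    · have hN : 2 ≤ designCoveringNumber μ J a ε := by
        rcases hcase with h | h | h
        · linarith
        -- One dimension with `l = c₀ / a` gives `log N ≥ (d/2) log (c₀ / a) - log ε`, which is
        -- positive exactly for `ε < (c₀ / a)^(d/2)`.
        · have h1 := (hasSpectralSubspace_unitLebesgue_one ha ha3.le).of_unitLebesgue hc₀ hμ
          refine two_le_of_log_pos ?_ (log_le_log_designCoveringNumber hμ J (by positivity) h1 hε)
          have h2 := Real.log_lt_log hε' h
          rw [Real.log_rpow (by positivity)] at h2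
          rw [mul_one_div]
          simp only [Nat.cast_one, one_pow, one_mul]
          linarith
        · exact two_le_of_ne_one (log_le_log_designCoveringNumber hμ J (by positivity)
            (hspec a 1 ha0 one_pos) hε) h
      refine le_trans (EReal.coe_le_coe_iff.2 ?_) (log_two_le_log_of_two_le hN)
      rw [mul_assoc]
      refine (mul_le_mul_of_nonneg_right (min_le_right _ _) hX).trans ?_
      refine (mul_le_mul_of_nonneg_left (bounded_entropy_rate hB4 ha0 ha3.le hL hLd.le)
        (by positivity)).trans (le_of_eq ?_)
      exact div_mul_cancel₀ _ hW.ne'
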